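/- Let $\mathbb{P}^1=\operatorname{Proj}\mathbb{Z}[x_0,x_1]$, $U_i=D_+(x_i)$, $t=x_1/x_0\in\mathcal{O}(U_0)$, $s=x_0/x_1\in\mathcal{O}(U_1)$, and let $k\ge 1$ and $n\in\mathbb{Z}$. Let $\mathcal{I}$ be the ideal sheaf of the diagonal in $\mathbb{P}^1\times_{\mathbb{Z}}\mathbb{P}^1$, let $\Delta^k$ be the closed subscheme defined by $\mathcal{I}^{k+1}$, let $p,q:\Delta^k\to\mathbb{P}^1$ be the restrictions of the first and second projection, and let $\mathrm{Pr}^k(\mathcal{O}(n))=p_*q^*\mathcal{O}(n)$ be the sheaf of principal parts, regarded as a left $\mathcal{O}$-module, that is, through $p$. For a function $a$ and a section $e$ of $\mathcal{O}(n)$ on an open set, write $da^j\otimes e=(q^\#a-p^\#a)^j\cdot q^*e$. Then $t$ and $s=t^{-1}$ identify $\mathcal{O}(U_0\cap U_1)$ with $\mathbb{Z}[t,t^{-1}]$. The sections $dt^j\otimes x_0^n$ $(0\le j\le k)$ form a basis of the left $\mathcal{O}(U_0)$-module $\mathrm{Pr}^k(\mathcal{O}(n))(U_0)$, the sections $ds^p\otimes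 x_1^n$ $(0\le p\le k)$ form a basis of the left $\mathcal{O}(U_1)$-module $\mathrm{Pr}^k(\mathcal{O}(n))(U_1)$, and the restrictions of both families to $U_0\cap U_1$ are bases of the left $\mathbb{Z}[t,t^{-1}]$-module $\mathrm{Pr}^k(\mathcal{O}(n))(U_0\cap U_1)$. The transition matrix $L^k_n$, whose $p$-th column holds the coordinates of $ds^p\otimes x_1^n$ in the basis $(dt^j\otimes x_0^n)_j$, lies in $GL(k+1,\mathbb{Z}[t,t^{-1}])$ and is given by the following formulas over $U_0\cap U_1$. If $n<0$, then for $0\le p\le k$ $$ds^p\otimes x_1^n=\sum_{j=p}^{k}(-1)^j\binom{j-n-1}{p-n-1}t^{n-p-j}\,dt^j\otimes x_0^n .$$ If $1\le k\le n$, then for $0\le p\le k$ $$ds^p\otimes x_1^n=\sum_{j=p}^{k}(-1)^p\binom{n-p}{j-p}t^{n-p-j}\,dt^j\otimes x_0^n .$$ If $0\le n<k$, then for $0\le p\le n$ $$ds^p\otimes x_1^n=\sum_{j=p}^{n}(-1)^p\binom{n-p}{j-p}t^{n-p-j}\,dt^j\otimes x_0^n ,$$ and for $n<p\le k$ $$ds^p\otimes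 x_1^n=\sum_{j=p}^{k}(-1)^j\binom{j-n-1}{p-n-1}t^{n-p-j}\,dt^j\otimes x_0^n .$$ -/

import Mathlib

open AlgebraicGeometry CategoryTheory Opposite TopologicalSpace
open scoped LaurentPolynomial

noncomputable section

universe u

/-! ### The twisting sheaves on `Proj` -/

namespace ProjTwist

variable {σ : Type*} {A : Type u} [CommRing A] [SetLike σ A] [AddSubgroupClass σ A]
variable (𝒜 : ℕ → σ)

/-- The homogeneous piece of degree `e : ℤ` of an `ℕ`-graded ring (zero for `e < 0`). -/
def intPiece (e : ℤ) : Set A := {a | a = 0 ∨ ∃ m : ℕ, (m : ℤ) = e ∧ a ∈ 𝒜 m}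

variable {𝒜} in
lemma intPiece.add {e : ℤ} {a b : A} (ha : a ∈ intPiece 𝒜 e) (hb : b ∈ intPiece 𝒜 e) :
    a + b ∈ intPiece 𝒜 e := by
  rcases ha with rfl | ⟨m, hm, ha⟩
  · simpa using hb
  rcases hb with rfl | ⟨m', hm', hb⟩
  · exact Or.inr ⟨m, hm, by simpa using ha⟩
  · obtain rfl : m = m' := by omega
    exact Or.inr ⟨m, hm, add_mem ha hb⟩

variable {𝒜} in
lemma intPiece.neg {e : ℤ} {a : A} (ha : a ∈ intPiece 𝒜 e) : -a ∈ intPiece 𝒜 e := by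
  rcases ha with rfl | ⟨m, hm, ha⟩
  · exact Or.inl (by simp)
  · exact Or.inr ⟨m, hm, neg_mem ha⟩

variable [GradedRing 𝒜]

variable {𝒜} in
lemma intPiece.mul {d : ℕ} {e e' : ℤ} {b a : A} (hb : b ∈ 𝒜 d) (ha : a ∈ intPiece 𝒜 e)
    (h : e' = d + e) : b * a ∈ intPiece 𝒜 e' := by
  rcases ha with rfl | ⟨m, hm, ha⟩
  · exact Or.inl (by simp)
  · exact Or.inr ⟨d + m, by push_cast; omega, SetLike.mul_mem_graded hb ha⟩

/-- The localization of the graded ring at (the complement of) the homogeneous prime `x`. -/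
abbrev Loc (x : ProjectiveSpectrum 𝒜) : Type u :=
  Localization x.asHomogeneousIdeal.toIdeal.primeCompl

lemma mul_notMem (x : ProjectiveSpectrum 𝒜) {a b : A} (ha : a ∉ x.asHomogeneousIdeal.toIdeal)
    (hb : b ∉ x.asHomogeneousIdeal.toIdeal) : a * b ∉ x.asHomogeneousIdeal.toIdeal :=
  x.asHomogeneousIdeal.toIdeal.primeCompl.mul_mem ha hb

/-- A dependent function on `U` is a fraction of degree `n` if it is of the form `x ↦ a / b`
with `a`, `b` homogeneous, `deg a - deg b = n`, and `b` vanishing nowhere on `U`. -/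
def IsFraction (n : ℤ) {U : Opens (ProjectiveSpectrum.top 𝒜)} (f : ∀ x : U, Loc 𝒜 x.1) : Prop :=
  ∃ (d : ℕ) (a b : A) (_ : b ∈ 𝒜 d) (_ : a ∈ intPiece 𝒜 (d + n))
    (hb : ∀ x : U, b ∉ x.1.asHomogeneousIdeal.toIdeal),
    ∀ x : U, f x = Localization.mk a ⟨b, hb x⟩

def isFractionPrelocal (n : ℤ) :
    TopCat.PrelocalPredicate (fun x : ProjectiveSpectrum.top 𝒜 => Loc 𝒜 x) where
  pred f := IsFraction 𝒜 n f
  res := by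
    rintro V U i f ⟨d, a, b, h1, h2, h3, w⟩
    exact ⟨d, a, b, h1, h2, fun x => h3 (i x), fun x => w (i x)⟩

/-- Locally a fraction of degree `n`. -/
def isLocallyFraction (n : ℤ) :
    TopCat.LocalPredicate (fun x : ProjectiveSpectrum.top 𝒜 => Loc 𝒜 x) :=
  (isFractionPrelocal 𝒜 n).sheafify

/-- Sections of `𝒪(n)` over `U`: the functions that are locally fractions of degree `n`. -/
def sections (n : ℤ) (U : (Opens (ProjectiveSpectrum.top 𝒜))ᵒᵖ) :
    AddSubgroup (∀ x : U.unop, Loc 𝒜 x.1) where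
  carrier := {f | (isLocallyFraction 𝒜 n).pred f}
  zero_mem' := fun x => ⟨unop U, x.2, 𝟙 _, 0, 0, 1, SetLike.GradedOne.one_mem, Or.inl rfl,
    fun y h => y.1.isPrime.ne_top ((Ideal.eq_top_iff_one _).2 h), fun y => by
      simp [Localization.mk_zero]⟩
  add_mem' := by
    intro f g hf hg x
    obtain ⟨V, mV, i, d, a, b, hb, ha, hV, w⟩ := hf x
    obtain ⟨V', mV', i', d', a', b', hb', ha', hV', w'⟩ := hg x
    refine ⟨V ⊓ V', ⟨mV, mV'⟩, Opens.infLELeft _ _ ≫ i, d + d', b * a' + b' * a, b * b',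
      SetLike.mul_mem_graded hb hb',
      intPiece.add (intPiece.mul hb ha' (by push_cast; ring))
        (intPiece.mul hb' ha (by push_cast; ring)),
      fun y => mul_notMem 𝒜 y.1 (hV ⟨y.1, y.2.1⟩) (hV' ⟨y.1, y.2.2⟩), fun y => ?_⟩
    have e := w ⟨y.1, y.2.1⟩
    have e' := w' ⟨y.1, y.2.2⟩
    dsimp only at e e' ⊢
    refine (congr_arg₂ (· + ·) e e').trans ?_
    simp only [Localization.add_mk]
    rfl
  neg_mem' := by
    intro f hf x
    obtain ⟨V, mV, i, d, a, b, hb, ha, hV, w⟩ := hf x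
    refine ⟨V, mV, i, d, -a, b, hb, intPiece.neg ha, hV, fun y => ?_⟩
    refine (congr_arg (- ·) (w y)).trans ?_
    simp only [Localization.neg_mk]

def sheafInType (n : ℤ) : TopCat.Sheaf (Type _) (ProjectiveSpectrum.top 𝒜) :=
  TopCat.subsheafToTypes (isLocallyFraction 𝒜 n)

instance (n : ℤ) (U : (Opens (ProjectiveSpectrum.top 𝒜))ᵒᵖ) :
    AddCommGroup ((sheafInType 𝒜 n).1.obj U) :=
  (sections 𝒜 n U).toAddCommGroup

lemma smul_mem (n : ℤ) (U : (Opens (ProjectiveSpectrum.top 𝒜))ᵒᵖ)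
    (r : (ProjectiveSpectrum.StructureSheaf.structureSheafInType 𝒜).1.obj U)
    (f : (sheafInType 𝒜 n).1.obj U) :
    (isLocallyFraction 𝒜 n).pred (fun x : U.unop => ((r.1 x).val * (show Loc 𝒜 x.1 from f.1 x) : Loc 𝒜 x.1)) := by
  intro x
  obtain ⟨V, mV, i, d, ⟨a, ha⟩, ⟨b, hb⟩, hV, w⟩ := r.2 x
  obtain ⟨V', mV', i', d', a', b', hb', ha', hV', w'⟩ := f.2 x
  refine ⟨V ⊓ V', ⟨mV, mV'⟩, Opens.infLELeft _ _ ≫ i, d + d', a * a', b * b',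
    SetLike.mul_mem_graded hb hb', intPiece.mul ha ha' (by push_cast; ring),
    fun y => mul_notMem 𝒜 y.1 (hV ⟨y.1, y.2.1⟩) (hV' ⟨y.1, y.2.2⟩), fun y => ?_⟩
  have e := congr_arg HomogeneousLocalization.val (w ⟨y.1, y.2.1⟩)
  have e' := w' ⟨y.1, y.2.2⟩
  dsimp only at e e' ⊢
  refine (congr_arg₂ (· * ·) e e').trans ?_
  simp only [HomogeneousLocalization.val_mk, Localization.mk_mul]
  rfl

instance (n : ℤ) (U : (Opens (ProjectiveSpectrum.top 𝒜))ᵒᵖ) :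
    Module ((ProjectiveSpectrum.StructureSheaf.structureSheafInType 𝒜).1.obj U)
      ((sheafInType 𝒜 n).1.obj U) where
  smul r f := ⟨fun x => ((r.1 x).val * (show Loc 𝒜 x.1 from f.1 x) : Loc 𝒜 x.1), smul_mem 𝒜 n U r f⟩
  one_smul f := Subtype.ext (funext fun x =>
    (congr_arg (· * f.1 x) HomogeneousLocalization.val_one).trans (one_mul _))
  mul_smul r s f := Subtype.ext (funext fun x =>
    (congr_arg (· * f.1 x) (HomogeneousLocalization.val_mul (r.1 x) (s.1 x))).trans
      (mul_assoc _ _ _))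
  smul_zero _ := Subtype.ext (funext fun _ => mul_zero _)
  smul_add _ _ _ := Subtype.ext (funext fun _ => mul_add _ _ _)
  add_smul r s f := Subtype.ext (funext fun x =>
    (congr_arg (· * f.1 x) (HomogeneousLocalization.val_add (r.1 x) (s.1 x))).trans
      (add_mul _ _ _))
  zero_smul f := Subtype.ext (funext fun x =>
    (congr_arg (· * f.1 x) HomogeneousLocalization.val_zero).trans (zero_mul _))

def presheafInAb (n : ℤ) : TopCat.Presheaf Ab (ProjectiveSpectrum.top 𝒜) where
  obj U := .of ((sheafInType 𝒜 n).1.obj U)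
  map i := AddCommGrpCat.ofHom
    { toFun := (sheafInType 𝒜 n).1.map i
      map_zero' := rfl
      map_add' := fun _ _ => rfl }

def presheafOfModules (n : ℤ) : _root_.PresheafOfModules
    (ProjectiveSpectrum.StructureSheaf.structurePresheafInCommRing 𝒜 ⋙
      forget₂ CommRingCat RingCat) :=
  letI (U : (Opens (ProjectiveSpectrum.top 𝒜))ᵒᵖ) :
      Module ((ProjectiveSpectrum.StructureSheaf.structurePresheafInCommRing 𝒜 ⋙
        forget₂ CommRingCat RingCat).obj U) ((presheafInAb 𝒜 n).obj U) :=
    inferInstanceAs (Module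
      ((ProjectiveSpectrum.StructureSheaf.structureSheafInType 𝒜).1.obj U)
      ((sheafInType 𝒜 n).1.obj U))
  .ofPresheaf (presheafInAb 𝒜 n) fun _ _ _ _ _ => rfl

/-- The twisting sheaf `𝒪(n)` on `Proj 𝒜`, as a sheaf of `𝒪`-modules. -/
def twist (n : ℤ) : (Proj 𝒜).Modules where
  val := presheafOfModules 𝒜 n
  isSheaf := (TopCat.Presheaf.isSheaf_iff_isSheaf_comp (forget AddCommGrpCat) _).2
    (sheafInType 𝒜 n).2

/-- For `f` of degree one, `f` is a unit in the localization at `x ∈ D₊(f)`. -/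
def unitAt (f : A) (x : ProjectiveSpectrum 𝒜) (hx : f ∉ x.asHomogeneousIdeal.toIdeal) :
    (Loc 𝒜 x)ˣ :=
  (IsLocalization.map_units (Loc 𝒜 x)
    (⟨f, hx⟩ : x.asHomogeneousIdeal.toIdeal.primeCompl)).unit

lemma unitAt_pow (f : A) (x : ProjectiveSpectrum 𝒜) (hx : f ∉ x.asHomogeneousIdeal.toIdeal)
    (m : ℕ) : ((unitAt 𝒜 f x hx ^ m : (Loc 𝒜 x)ˣ) : Loc 𝒜 x) = Localization.mk (f ^ m) 1 := by
  rw [Localization.mk_one_eq_algebraMap, map_pow, Units.val_pow_eq_pow_val]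
  rfl

lemma unitAt_zpow_negSucc (f : A) (x : ProjectiveSpectrum 𝒜)
    (hx : f ∉ x.asHomogeneousIdeal.toIdeal) (m : ℕ)
    (hm : f ^ (m + 1) ∈ x.asHomogeneousIdeal.toIdeal.primeCompl) :
    ((unitAt 𝒜 f x hx ^ Int.negSucc m : (Loc 𝒜 x)ˣ) : Loc 𝒜 x) =
      Localization.mk 1 ⟨f ^ (m + 1), hm⟩ := by
  rw [zpow_negSucc, Units.inv_eq_of_mul_eq_one_right]
  rw [unitAt_pow, Localization.mk_mul, mul_one, one_mul]
  exact Localization.mk_self (⟨f ^ (m + 1), hm⟩ : x.asHomogeneousIdeal.toIdeal.primeCompl)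

lemma unitAt_zpow_isFraction {f : A} (hf : f ∈ 𝒜 1) (n : ℤ) :
    IsFraction 𝒜 n (U := ProjectiveSpectrum.basicOpen 𝒜 f)
      (fun x => ((unitAt 𝒜 f x.1 x.2 ^ n : (Loc 𝒜 x.1)ˣ) : Loc 𝒜 x.1)) := by
  rcases n with m | m
  · exact ⟨0, f ^ m, 1, SetLike.GradedOne.one_mem,
      Or.inr ⟨m, by simp, by simpa using SetLike.pow_mem_graded m hf⟩,
      fun y h => y.1.isPrime.ne_top ((Ideal.eq_top_iff_one _).2 h),
      fun x => unitAt_pow 𝒜 f x.1 x.2 m⟩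
  · exact ⟨m + 1, 1, f ^ (m + 1), by simpa using SetLike.pow_mem_graded (m + 1) hf,
      Or.inr ⟨0, by simp [Int.negSucc_eq], SetLike.GradedOne.one_mem⟩,
      fun y h => y.2 (y.1.isPrime.mem_of_pow_mem _ h),
      fun x => unitAt_zpow_negSucc 𝒜 f x.1 x.2 m _⟩

/-- For `f` of degree one and `n : ℤ`, the section `fⁿ` of `𝒪(n)` over `D₊(f)`. -/
def powSection {f : A} (hf : f ∈ 𝒜 1) (n : ℤ) : Γ(twist 𝒜 n, Proj.basicOpen 𝒜 f) :=
  (⟨fun x => ((unitAt 𝒜 f x.1 x.2 ^ n : (Loc 𝒜 x.1)ˣ) : Loc 𝒜 x.1),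
    (isFractionPrelocal 𝒜 n).sheafifyOf (unitAt_zpow_isFraction 𝒜 hf n)⟩ :
    (sheafInType 𝒜 n).1.obj (op (ProjectiveSpectrum.basicOpen 𝒜 f)))

/-- For `a`, `f` of degree one, the regular function `a / f` on `D₊(f)`. -/
def ratio {a f : A} (ha : a ∈ 𝒜 1) (hf : f ∈ 𝒜 1) : Γ(Proj 𝒜, Proj.basicOpen 𝒜 f) :=
  Proj.awayToSection 𝒜 f (HomogeneousLocalization.Away.mk 𝒜 hf 1 a (by simpa using ha))

end ProjTwist

/-! ### Principal parts -/

namespace PrincipalParts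

variable {X S : Scheme.{u}} (f : X ⟶ S) (k : ℕ)

/-- The `k`-th infinitesimal neighbourhood `Δᵏ` of the diagonal: the closed subscheme of
`X ×_S X` cut out by `I ^ (k + 1)`, with `I` the ideal sheaf of the diagonal. -/
def diagNhd : Scheme.{u} := ((Limits.pullback.diagonal f).ker ^ (k + 1)).subscheme

/-- The closed immersion `Δᵏ ⟶ X ×_S X`. -/
def diagNhdι : diagNhd f k ⟶ Limits.pullback f f :=
  ((Limits.pullback.diagonal f).ker ^ (k + 1)).subschemeι

/-- The first projection restricted to `Δᵏ`. -/
def p : diagNhd f k ⟶ X := diagNhdι f k ≫ Limits.pullback.fst f f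

/-- The second projection restricted to `Δᵏ`. -/
def q : diagNhd f k ⟶ X := diagNhdι f k ≫ Limits.pullback.snd f f

/-- The sheaf of principal parts `p_* (𝒪_{Δᵏ} ⊗ q^* E)` of order `k`, computed on the
closed subscheme `Δᵏ`, with its left `𝒪_X`-module structure (the one coming from `p`). -/
def principalParts (E : X.Modules) : X.Modules :=
  (Scheme.Modules.pushforward (p f k)).obj ((Scheme.Modules.pullback (q f k)).obj E)

lemma p_apply_eq_q_apply [IsSeparated f] (z : diagNhd f k) : p f k z = q f k z := by
  have hz : diagNhdι f k z ∈ ((Limits.pullback.diagonal f).ker ^ (k + 1)).support := by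
    have := Set.mem_range_self (f := ((Limits.pullback.diagonal f).ker ^ (k + 1)).subschemeι) z
    rwa [Scheme.IdealSheafData.range_subschemeι] at this
  rw [Scheme.IdealSheafData.support_pow_succ] at hz
  have hz' : diagNhdι f k z ∈ closure (Set.range (Limits.pullback.diagonal f)) := by
    rw [← Scheme.Hom.support_ker]; exact hz
  rw [(Limits.pullback.diagonal f).isClosedEmbedding.isClosed_range.closure_eq] at hz'
  obtain ⟨x, hx⟩ := hz'
  simp only [p, q, Scheme.Hom.comp_apply, ← hx]
  rw [← Scheme.Hom.comp_apply, ← Scheme.Hom.comp_apply]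
  simp

lemma preimage_le [IsSeparated f] (U : X.Opens) : p f k ⁻¹ᵁ U ≤ q f k ⁻¹ᵁ U := by
  intro z hz
  change q f k z ∈ U
  rw [← p_apply_eq_q_apply]
  exact hz

variable {f} [IsSeparated f] {U : X.Opens} {E : X.Modules}

/-- `1 ⊗ e`, for a section `e` of `E` over `U`. -/
def oneTmul (e : Γ(E, U)) : Γ((Scheme.Modules.pullback (q f k)).obj E, p f k ⁻¹ᵁ U) :=
  ((Scheme.Modules.pullback (q f k)).obj E).presheaf.map (homOfLE (preimage_le f k U)).op
    (((Scheme.Modules.pullbackPushforwardAdjunction (q f k)).unit.app E).app U e)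

variable (f) in
/-- `da = 1 ⊗ a - a ⊗ 1`, for a function `a` on `U`. -/
def diff (a : Γ(X, U)) : Γ(diagNhd f k, p f k ⁻¹ᵁ U) :=
  (diagNhd f k).presheaf.map (homOfLE (preimage_le f k U)).op ((q f k).app U a) - (p f k).app U a

variable (f) in
/-- The section `da ^ j ⊗ e` of the sheaf of principal parts of `E` over `U`. -/
def dPow (a : Γ(X, U)) (j : ℕ) (e : Γ(E, U)) : Γ(principalParts f k E, U) :=
  (diff f k a ^ j • oneTmul k e : Γ((Scheme.Modules.pullback (q f k)).obj E, p f k ⁻¹ᵁ U))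

end PrincipalParts

/-! ### The projective line over `ℤ` -/

namespace P1Z

instance : GradedAlgebra (MvPolynomial.homogeneousSubmodule (Fin 2) ℤ) :=
  MvPolynomial.gradedAlgebra

/-- `ℙ¹ = Proj ℤ[x₀, x₁]`. -/
abbrev P1 : Scheme.{0} := Proj (MvPolynomial.homogeneousSubmodule (Fin 2) ℤ)

/-- The structure morphism to `Spec ℤ`. -/
def toSpecZ : P1 ⟶ Spec (.of ℤ) := specZIsTerminal.from P1

instance : IsSeparated toSpecZ := by
  infer_instance

lemma X_mem (i : Fin 2) :
    (MvPolynomial.X i : MvPolynomial (Fin 2) ℤ) ∈ MvPolynomial.homogeneousSubmodule (Fin 2) ℤ 1 :=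
  MvPolynomial.isHomogeneous_X ℤ i

/-- The standard open `Uᵢ = D₊(xᵢ)`. -/
abbrev U (i : Fin 2) : P1.Opens := Proj.basicOpen _ (MvPolynomial.X i)

/-- The line bundle `𝒪(n)`. -/
abbrev twist (n : ℤ) : P1.Modules := ProjTwist.twist _ n

/-- The section `xᵢⁿ` of `𝒪(n)` over `Uᵢ`. -/
def xPow (i : Fin 2) (n : ℤ) : Γ(twist n, U i) := ProjTwist.powSection _ (X_mem i) n

/-- `t = x₁ / x₀` on `U₀`. -/
def t : Γ(P1, U 0) := ProjTwist.ratio _ (X_mem 1) (X_mem 0)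

/-- `s = x₀ / x₁` on `U₁`. -/
def s : Γ(P1, U 1) := ProjTwist.ratio _ (X_mem 0) (X_mem 1)

/-- The sheaf of principal parts of `𝒪(n)`, as a left `𝒪`-module. -/
abbrev PP (k : ℕ) (n : ℤ) : P1.Modules := PrincipalParts.principalParts toSpecZ k (twist n)

/-- `dtʲ ⊗ x₀ⁿ` on `U₀`. -/
def dt (k : ℕ) (n : ℤ) (j : ℕ) : Γ(PP k n, U 0) := PrincipalParts.dPow toSpecZ k t j (xPow 0 n)

/-- `dsᵖ ⊗ x₁ⁿ` on `U₁`. -/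
def ds (k : ℕ) (n : ℤ) (p : ℕ) : Γ(PP k n, U 1) := PrincipalParts.dPow toSpecZ k s p (xPow 1 n)

/-- The overlap `U₀ ∩ U₁`. -/
abbrev U01 : P1.Opens := U 0 ⊓ U 1

/-- `t` on the overlap. -/
def t01 : Γ(P1, U01) := P1.presheaf.map (homOfLE inf_le_left).op t

/-- `s` on the overlap. -/
def s01 : Γ(P1, U01) := P1.presheaf.map (homOfLE inf_le_right).op s

/-- `dtʲ ⊗ x₀ⁿ` on the overlap. -/
def dt01 (k : ℕ) (n : ℤ) (j : ℕ) : Γ(PP k n, U01) :=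
  (PP k n).presheaf.map (homOfLE (inf_le_left : U01 ≤ U 0)).op (dt k n j)

/-- `dsᵖ ⊗ x₁ⁿ` on the overlap. -/
def ds01 (k : ℕ) (n : ℤ) (p : ℕ) : Γ(PP k n, U01) :=
  (PP k n).presheaf.map (homOfLE (inf_le_right : U01 ≤ U 1)).op (ds k n p)

end P1Z

end

/-!
Over an affine open `V` with a coordinate `a`, the sections of the sheaf of principal parts of
`𝒪(n)` are computed in two independent steps.

*The module.* A section `e` of a module `M` over `U` trivializes `M` if `r ↦ r • e|_V` is bijective
for all `V ≤ U`. This property is preserved by pullback along any morphism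
(`Scheme.Modules.Trivializes.pullback`). The proof avoids describing the sections of a pullback:
if `e` trivializes `M`, then morphisms from `M` to any module `P` for which all the restrictions
`P(V) → P(V ∩ U)` are bijective correspond to the sections of `P` over `U`, by evaluation at `e`
(`Trivializes.hom_bijective`). This universal property passes through the adjunction between
pullback and pushforward, and it implies triviality again, by Yoneda
(`trivializes_of_hom_bijective`). Since `xᵢⁿ` trivializes `𝒪(n)` over `D₊(xᵢ)`
(`ProjTwist.trivializes_powSection`), the sections of `q^* 𝒪(n)` over `p⁻¹ V` are the functions on
that open subscheme of `Δᵏ`, times `1 ⊗ xᵢⁿ`.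

*The functions.* For `V` affine with `A = Γ(X, V)`, the functions on `V ×_ℤ V` form the coproduct
`C` of two copies of `A`, and the functions on `p⁻¹ V ⊆ Δᵏ` are `C / (ker δ) ^ (k + 1)`, where
`δ : C → A` is the restriction to the diagonal. The only facts about `A` that matter are recorded in
`IsCoordinate a`: ring homomorphisms out of `A` are determined by the image of `a`, and there is a
Taylor expansion `A → A⟦X⟧` with `a ↦ a + X`. The first fact gives `ker δ = (1 ⊗ a - a ⊗ 1)`, hence
that the powers of `da` generate; the second one, applied to the right factor of `C`, shows that
they are linearly independent (`IsCoordinate.bijective_sum`). Both hold for `X` in `ℤ[X]` and for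
`T`, `T⁻¹` in `ℤ[T;T⁻¹]`, which are the rings of functions on `Uᵢ` and on `U₀ ∩ U₁`.

*The formulas.* With `τ = dt` the function `t` pulls back along `q` to `t + τ`, so that
`ds = -t⁻¹ (t + τ)⁻¹ τ` and `x₁ⁿ = tⁿ x₀ⁿ` give
`dsᵖ ⊗ x₁ⁿ = (-1)ᵖ t⁻ᵖ τᵖ (t + τ)ⁿ⁻ᵖ ⊗ x₀ⁿ`. This is expanded by the binomial theorem if
`p ≤ n` (`pow_mul_map_T_eq_sum_of_le`), and by the negative binomial series, which is finite as
`τᵏ⁺¹ = 0`, if `n < p` (`pow_mul_map_T_eq_sum_of_lt`).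
-/

noncomputable section

universe u

/-! ### Trivializing sections of modules and their pullbacks -/

namespace AlgebraicGeometry.Scheme.Modules

variable {X Y : Scheme.{u}}

/-- The section `e` of `M` over `U` generates `M|_U` freely: over every `V ≤ U`, multiplication of
functions with the restriction of `e` is bijective. -/
def Trivializes (M : X.Modules) {U : X.Opens} (e : Γ(M, U)) : Prop :=
  ∀ (V : X.Opens) (h : V ≤ U),
    Function.Bijective fun r : Γ(X, V) ↦ r • M.presheaf.map (homOfLE h).op e

/-- A morphism of modules from an additive, linear and natural family of maps on sections. -/
def homOfApp {M P : X.Modules} (φ : ∀ V : X.Opens, Γ(M, V) → Γ(P, V))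
    (hadd : ∀ V x y, φ V (x + y) = φ V x + φ V y)
    (hsmul : ∀ V (r : Γ(X, V)) x, φ V (r • x) = r • φ V x)
    (hnat : ∀ (V W : X.Opens) (i : W ⟶ V) x,
      φ W (M.presheaf.map i.op x) = P.presheaf.map i.op (φ V x)) : M ⟶ P :=
  SheafOfModules.Hom.mk (PresheafOfModules.homMk (M₁ := M.val) (M₂ := P.val)
    { app V := AddCommGrpCat.ofHom (AddMonoidHom.mk' (φ V.unop) (hadd V.unop))
      naturality V W i := by
        ext x
        exact hnat V.unop W.unop i.unop x }
    fun V r x ↦ hsmul V.unop r x)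

lemma homOfApp_app {M P : X.Modules} (φ : ∀ V : X.Opens, Γ(M, V) → Γ(P, V))
    (hadd hsmul hnat) (V : X.Opens) (x : Γ(M, V)) :
    (homOfApp (M := M) (P := P) φ hadd hsmul hnat).app V x = φ V x := rfl

lemma map_map {M : X.Modules} {U V W : X.Opens} (h : V ≤ U) (h' : W ≤ V) (x : Γ(M, U)) :
    M.presheaf.map (homOfLE h').op (M.presheaf.map (homOfLE h).op x) =
      M.presheaf.map (homOfLE (h'.trans h)).op x := by
  rw [← ConcreteCategory.comp_apply, ← Functor.map_comp]
  rfl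

lemma app_map {M P : X.Modules} (ψ : M ⟶ P) {U V : X.Opens} (h : V ≤ U) (x : Γ(M, U)) :
    ψ.app V (M.presheaf.map (homOfLE h).op x) = P.presheaf.map (homOfLE h).op (ψ.app U x) :=
  congr($(ψ.mapPresheaf.naturality (homOfLE h).op) x)

/-- If `e` trivializes `M` over `U`, morphisms from `M` to a module `P` that is the extension of its
restriction to `U` amount to sections of `P` over `U`. -/
lemma Trivializes.hom_bijective {M : X.Modules} {U : X.Opens} {e : Γ(M, U)} (he : Trivializes M e)
    (P : X.Modules)
    (hP : ∀ V : X.Opens, Function.Bijective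
      (P.presheaf.map (homOfLE (inf_le_left : V ⊓ U ≤ V)).op)) :
    Function.Bijective fun ψ : M ⟶ P ↦ ψ.app U e := by
  constructor
  · intro ψ ψ' h
    dsimp only at h
    refine hom_ext _ _ fun V ↦ ?_
    ext m
    refine (hP V).1 ?_
    rw [← app_map, ← app_map]
    obtain ⟨r, hr⟩ := (he (V ⊓ U) inf_le_right).2 (M.presheaf.map (homOfLE inf_le_left).op m)
    dsimp only at hr
    rw [← hr, Hom.app_smul, Hom.app_smul, app_map, app_map, h]
  · intro x
    -- `c V m` is the coordinate of `m` over `V ⊓ U`, and `φ V m` extends `c V m • x` to `V`.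
    choose c hc using fun (V : X.Opens) (m : Γ(M, V)) ↦
      (he (V ⊓ U) inf_le_right).2 (M.presheaf.map (homOfLE inf_le_left).op m)
    choose φ hφ using fun (V : X.Opens) (m : Γ(M, V)) ↦
      (hP V).2 (c V m • P.presheaf.map (homOfLE inf_le_right).op x)
    dsimp only at hc
    refine ⟨homOfApp φ (fun V m m' ↦ (hP V).1 ?_) (fun V r m ↦ (hP V).1 ?_)
      (fun V W i m ↦ (hP W).1 ?_), ?_⟩
    · rw [map_add, hφ, hφ, hφ, ← add_smul]
      congr 1
      refine (he (V ⊓ U) inf_le_right).1 ?_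
      dsimp only
      rw [add_smul, hc, hc, hc, map_add]
    · rw [map_smul, hφ, hφ, smul_smul]
      congr 1
      refine (he (V ⊓ U) inf_le_right).1 ?_
      dsimp only
      rw [mul_smul, hc, hc, map_smul]
    · have hi : W ≤ V := leOfHom i
      have hWV : W ⊓ U ≤ V ⊓ U := inf_le_inf_right _ hi
      obtain rfl : i = homOfLE hi := rfl
      rw [hφ, map_map, ← map_map (inf_le_left : V ⊓ U ≤ V) hWV, hφ, map_smul, map_map]
      congr 1
      refine (he (W ⊓ U) inf_le_right).1 ?_
      dsimp only
      rw [hc, map_map, ← map_map (inf_le_right : V ⊓ U ≤ U) hWV, ← map_smul, hc, map_map]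
    · dsimp only
      rw [homOfApp_app]
      refine (hP U).1 ?_
      rw [hφ]
      have h1 : c U e = 1 := by
        refine (he (U ⊓ U) inf_le_right).1 ?_
        dsimp only
        rw [hc, one_smul]
      rw [h1, one_smul]

lemma map_self {M : X.Modules} {U : X.Opens} (x : Γ(M, U)) :
    M.presheaf.map (homOfLE (le_refl U)).op x = x := by
  have : (homOfLE (le_refl U)).op = 𝟙 (op U) := rfl
  rw [this, CategoryTheory.Functor.map_id]
  rfl

lemma Trivializes.map {M : X.Modules} {U V : X.Opens} {e : Γ(M, U)} (he : Trivializes M e)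
    (h : V ≤ U) : Trivializes M (M.presheaf.map (homOfLE h).op e) := by
  intro W hW
  simpa only [map_map] using he W (hW.trans h)

lemma map_bijective_of_eq (P : X.Modules) {U V : X.Opens} (h : V = U) :
    Function.Bijective (P.presheaf.map (homOfLE h.le).op) := by
  subst h
  rw [show ⇑(P.presheaf.map (homOfLE _).op) = id from funext fun x ↦ map_self x]
  exact Function.bijective_id

variable (X) in
/-- The structure sheaf as a module over itself. -/
def structureModule : X.Modules := SheafOfModules.unit X.ringCatSheaf

variable (X) in
/-- The section `1` of the structure sheaf over `U`. -/
def unitOne (U : X.Opens) : Γ(structureModule X, U) :=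
  (1 : Γ(X, U))

lemma trivializes_unitOne (U : X.Opens) :
    Trivializes (structureModule X) (unitOne X U) := by
  intro V h
  have : (fun r : Γ(X, V) ↦ r • (structureModule X).presheaf.map
      (homOfLE h).op (unitOne X U)) = fun r ↦ r := by
    funext r
    change r * X.presheaf.map (homOfLE h).op 1 = r
    rw [map_one, mul_one]
  rw [this]
  exact Function.bijective_id

/-- The converse of `Trivializes.hom_bijective`: multiplication with `e`, as a morphism from the
structure sheaf of `U` to the restriction of `G`, is an isomorphism by Yoneda. -/
lemma trivializes_of_hom_bijective {G : X.Modules} {U : X.Opens} {e : Γ(G, U)}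
    (H : ∀ P : X.Modules, (∀ V : X.Opens, Function.Bijective
      (P.presheaf.map (homOfLE (inf_le_left : V ⊓ U ≤ V)).op)) →
      Function.Bijective fun ψ : G ⟶ P ↦ ψ.app U e) : Trivializes G e := by
  let e' : Γ(G.restrict U.ι, U.ι ⁻¹ᵁ U) :=
    G.presheaf.map (homOfLE (U.ι.image_preimage_le U)).op e
  -- `U.ι ⁻¹ᵁ U` is all of `U`, so every module on `U` satisfies the hypothesis on `P`.
  have hN (N : U.toScheme.Modules) (V : U.toScheme.Opens) : Function.Bijective
      (N.presheaf.map (homOfLE (inf_le_left : V ⊓ U.ι ⁻¹ᵁ U ≤ V)).op) :=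
    map_bijective_of_eq N (by simp)
  have hu (N : U.toScheme.Modules) :=
    (trivializes_unitOne (X := U.toScheme) (U.ι ⁻¹ᵁ U)).hom_bijective N (hN N)
  obtain ⟨s, hs⟩ := (hu (G.restrict U.ι)).2 e'
  dsimp only at hs
  have : IsIso s := by
    rw [isIso_iff_coyoneda_map_bijective]
    intro N
    rw [← (hu N).of_comp_iff']
    have h2 : (fun θ : G.restrict U.ι ⟶ N ↦ θ.app (U.ι ⁻¹ᵁ U) e') =
        (fun ψ : G ⟶ (pushforward U.ι).obj N ↦ ψ.app U e) ∘
          ((restrictAdjunction U.ι).homEquiv G N) := by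
      funext θ
      simp only [Function.comp_apply, Adjunction.homEquiv_unit]
      rfl
    have h3 : ((fun ψ : structureModule U.toScheme ⟶ N ↦
        ψ.app (U.ι ⁻¹ᵁ U) (unitOne _ _)) ∘ fun x ↦ s ≫ x) =
        fun θ : G.restrict U.ι ⟶ N ↦ θ.app (U.ι ⁻¹ᵁ U) e' := by
      funext θ
      simp only [Function.comp_apply, Hom.comp_app]
      rw [← hs]
      rfl
    rw [h3, h2]
    refine (H _ fun V ↦ ?_).comp (Equiv.bijective _)
    exact map_bijective_of_eq N (U := U.ι ⁻¹ᵁ V) (V := U.ι ⁻¹ᵁ (V ⊓ U))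
      (Opens.ext (Set.ext fun x ↦ ⟨fun h ↦ h.1, fun h ↦ ⟨h, x.2⟩⟩))
  intro W hW
  obtain ⟨V, rfl⟩ : ∃ V, U.ι ''ᵁ V = W := ⟨U.ι ⁻¹ᵁ W, by
    rw [U.ι.image_preimage_eq_opensRange_inf, Opens.opensRange_ι]; exact inf_eq_right.2 hW⟩
  have hb : Function.Bijective (s.app V) := ConcreteCategory.bijective_of_isIso (s.app V)
  have hVle : V ≤ U.ι ⁻¹ᵁ U := by simp
  have key (r : Γ(U, V)) : s.app V r = (U.ι.appIso V).inv r • G.presheaf.map (homOfLE hW).op e := by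
    have h1 : (show Γ(structureModule U.toScheme, V) from r) =
        (show Γ(U, V) from r) •
          (structureModule U.toScheme).presheaf.map (homOfLE hVle).op (unitOne _ _) := by
      change r = r * U.toScheme.presheaf.map (homOfLE hVle).op 1
      rw [map_one, mul_one]
    refine (congrArg (s.app V) h1).trans ?_
    rw [Hom.app_smul, app_map, hs]
    exact congrArg (fun z : Γ(G, U.ι ''ᵁ V) ↦ (U.ι.appIso V).inv r • z)
      (map_map (U.ι.image_preimage_le U) (U.ι.image_mono hVle) e)
  have hcomp := hb.comp (ConcreteCategory.bijective_of_isIso (U.ι.appIso V).hom)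
  have h4 : (fun r : Γ(X, U.ι ''ᵁ V) ↦ r • G.presheaf.map (homOfLE hW).op e) =
      s.app V ∘ (U.ι.appIso V).hom := by
    funext r
    refine Eq.trans ?_ (key ((U.ι.appIso V).hom r)).symm
    rw [← ConcreteCategory.comp_apply, Iso.hom_inv_id]
    rfl
  exact h4.symm ▸ hcomp

/-- The pullback of a trivializing section is trivializing. -/
lemma Trivializes.pullback (f : Y ⟶ X) {M : X.Modules} {U : X.Opens} {e : Γ(M, U)}
    (he : Trivializes M e) :
    Trivializes ((pullback f).obj M) (U := f ⁻¹ᵁ U)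
      (((pullbackPushforwardAdjunction f).unit.app M).app U e) := by
  refine trivializes_of_hom_bijective fun P hP ↦ ?_
  have h := (he.hom_bijective ((pushforward f).obj P) fun V ↦ hP (f ⁻¹ᵁ V)).comp
    ((pullbackPushforwardAdjunction f).homEquiv M P).bijective
  have h' : (fun ψ ↦ ψ.app (f ⁻¹ᵁ U)
        (((pullbackPushforwardAdjunction f).unit.app M).app U e)) =
      (fun ψ : M ⟶ (pushforward f).obj P ↦ ψ.app U e) ∘
        ((pullbackPushforwardAdjunction f).homEquiv M P) := by
    funext ψ
    simp only [Function.comp_apply, Adjunction.homEquiv_unit]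
    rfl
  exact h'.symm ▸ h

end AlgebraicGeometry.Scheme.Modules

/-! ### Coordinates of rings and truncations of the coproduct -/

namespace PrincipalParts

open scoped PowerSeries

/-- `t` is a coordinate of the ring `A` over `ℤ`: ring homomorphisms out of `A` are determined by
their value at `t`, and `t ↦ t + X` extends to a ring homomorphism `A →+* A⟦X⟧`
(which is the identity modulo `X` by the first property). -/
structure IsCoordinate {A : Type u} [CommRing A] (t : A) : Prop where
  hom_ext : ∀ {B : Type u} [CommRing B] (g h : A →+* B), g t = h t → g = h
  exists_taylor : ∃ g : A →+* A⟦X⟧, g t = PowerSeries.C t + PowerSeries.X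

namespace IsCoordinate

variable {A A' : Type u} [CommRing A] [CommRing A'] {t : A}

lemma map_equiv (ht : IsCoordinate t) (φ : A ≃+* A') : IsCoordinate (φ t) where
  hom_ext g h hgh := by
    have := ht.hom_ext (g.comp φ.toRingHom) (h.comp φ.toRingHom) hgh
    ext x
    simpa using congr($this (φ.symm x))
  exists_taylor := by
    obtain ⟨g, hg⟩ := ht.exists_taylor
    exact ⟨(PowerSeries.map φ.toRingHom).comp (g.comp φ.symm.toRingHom), by simp [hg]⟩

lemma polynomial_X : IsCoordinate (Polynomial.X : Polynomial ℤ) where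
  hom_ext g h hgh := Polynomial.ringHom_ext' (Subsingleton.elim _ _) hgh
  exists_taylor := ⟨(Polynomial.aeval (PowerSeries.C Polynomial.X + PowerSeries.X)).toRingHom,
    by simp⟩

lemma laurent_T : IsCoordinate (LaurentPolynomial.T 1 : ℤ[T;T⁻¹]) where
  hom_ext {B} _ g h hgh := by
    refine IsLocalization.ringHom_ext (Submonoid.powers (Polynomial.X : Polynomial ℤ)) ?_
    refine Polynomial.ringHom_ext' (Subsingleton.elim _ _) ?_
    simpa using hgh
  exists_taylor := by
    have hu : IsUnit (Polynomial.aeval (R := ℤ) (PowerSeries.C (LaurentPolynomial.T 1 : ℤ[T;T⁻¹]) +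
        PowerSeries.X) Polynomial.X) := by
      rw [Polynomial.aeval_X, PowerSeries.isUnit_iff_constantCoeff]
      simpa using LaurentPolynomial.isUnit_T 1
    refine ⟨IsLocalization.Away.lift (Polynomial.X : Polynomial ℤ) (g := (Polynomial.aeval (R := ℤ)
      (PowerSeries.C (LaurentPolynomial.T 1 : ℤ[T;T⁻¹]) + PowerSeries.X)).toRingHom) hu, ?_⟩
    have hX : algebraMap (Polynomial ℤ) ℤ[T;T⁻¹] Polynomial.X = LaurentPolynomial.T 1 := by
      rw [LaurentPolynomial.algebraMap_eq_toLaurent, Polynomial.toLaurent_X]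
    refine (congrArg _ hX.symm).trans ((IsLocalization.Away.lift_eq _ hu _).trans ?_)
    simp

lemma laurent_T_neg : IsCoordinate (LaurentPolynomial.T (-1) : ℤ[T;T⁻¹]) := by
  simpa using laurent_T.map_equiv (LaurentPolynomial.invert (R := ℤ)).toRingEquiv

variable {C Q : Type u} [CommRing C] [CommRing Q] {i₁ i₂ : A →+* C} {δ : C →+* A} {π : C →+* Q}

/-- If `C` is the coproduct of two copies of `A`, the kernel of the codiagonal `δ` is generated by
`i₂ t - i₁ t`, since the two maps from `A` to the quotient by this element agree. -/
lemma ker_eq_span (ht : IsCoordinate t)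
    (hext : ∀ {B : Type u} [CommRing B] (g h : C →+* B), g.comp i₁ = h.comp i₁ →
      g.comp i₂ = h.comp i₂ → g = h)
    (hδ₁ : δ.comp i₁ = RingHom.id A) (hδ₂ : δ.comp i₂ = RingHom.id A) :
    RingHom.ker δ = Ideal.span {i₂ t - i₁ t} := by
  have h1 (a : A) : δ (i₁ a) = a := congr($hδ₁ a)
  have h2 (a : A) : δ (i₂ a) = a := congr($hδ₂ a)
  apply le_antisymm
  · intro c hc
    set m := Ideal.Quotient.mk (Ideal.span {i₂ t - i₁ t})
    have e₀ : m (i₂ t) = m (i₁ t) :=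
      Ideal.Quotient.eq.2 (Ideal.subset_span (Set.mem_singleton _))
    have e : m.comp i₁ = m.comp i₂ := ht.hom_ext _ _ e₀.symm
    have e' : m = (m.comp i₁).comp δ := by
      refine hext _ _ ?_ ?_
      · rw [RingHom.comp_assoc, hδ₁, RingHom.comp_id]
      · rw [RingHom.comp_assoc, hδ₂, RingHom.comp_id, e]
    have := congr($e' c)
    rw [RingHom.comp_apply, RingHom.mem_ker.1 hc, map_zero] at this
    exact Ideal.Quotient.eq_zero_iff_mem.1 this
  · rw [Ideal.span_singleton_le_iff_mem, RingHom.mem_ker, map_sub, h1, h2, sub_self]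

/-- If `C` is the coproduct of two copies of `A`, with codiagonal `δ`, and `Q` is the quotient of
`C` by `(ker δ) ^ (k + 1)`, the powers of the class of `i₂ t - i₁ t` of exponent at most `k` form a
basis of the left `A`-module `Q`. -/
lemma bijective_sum (ht : IsCoordinate t) (k : ℕ)
    (hext : ∀ {B : Type u} [CommRing B] (g h : C →+* B), g.comp i₁ = h.comp i₁ →
      g.comp i₂ = h.comp i₂ → g = h)
    (hdesc : ∀ {B : Type u} [CommRing B] (a b : A →+* B),
      ∃ g : C →+* B, g.comp i₁ = a ∧ g.comp i₂ = b)
    (hδ₁ : δ.comp i₁ = RingHom.id A) (hδ₂ : δ.comp i₂ = RingHom.id A)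
    (hπ : Function.Surjective π) (hker : RingHom.ker π = RingHom.ker δ ^ (k + 1)) :
    Function.Bijective fun a : Fin (k + 1) → A ↦
      ∑ j, π (i₁ (a j)) * π (i₂ t - i₁ t) ^ (j : ℕ) := by
  have hδ := ht.ker_eq_span hext hδ₁ hδ₂
  rw [hδ, Ideal.span_singleton_pow] at hker
  constructor
  · intro a b hab
    obtain ⟨g, hg⟩ := ht.exists_taylor
    -- `G` maps the sum with coefficients `a` to the power series with coefficients `a`.
    obtain ⟨G, hG₁, hG₂⟩ := hdesc PowerSeries.C g
    have h1 (a : A) : G (i₁ a) = PowerSeries.C a := congr($hG₁ a)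
    have h2 : G (i₂ t) - PowerSeries.C t = PowerSeries.X := by
      rw [← RingHom.comp_apply G i₂, hG₂, hg, add_sub_cancel_left]
    have hmem : (∑ j, i₁ (a j) * (i₂ t - i₁ t) ^ (j : ℕ)) -
        ∑ j, i₁ (b j) * (i₂ t - i₁ t) ^ (j : ℕ) ∈ Ideal.span {(i₂ t - i₁ t) ^ (k + 1)} := by
      rw [← hker, RingHom.mem_ker, map_sub, sub_eq_zero]
      simpa using hab
    obtain ⟨c, hc⟩ := Ideal.mem_span_singleton.1 hmem
    have hG := congrArg G hc
    simp only [map_sub, map_sum, map_mul, map_pow, h1, h2] at hG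
    funext i
    have hi := congrArg (PowerSeries.coeff (i : ℕ)) hG
    have hX : PowerSeries.coeff (i : ℕ) ((PowerSeries.X : A⟦X⟧) ^ (k + 1) * G c) = 0 := by
      rw [PowerSeries.coeff_X_pow_mul', if_neg (by omega)]
    rw [hX, map_sub, map_sum, map_sum] at hi
    simpa [PowerSeries.coeff_C_mul, PowerSeries.coeff_X_pow, Fin.val_inj, sub_eq_zero] using hi
  · have hstep (m : ℕ) (c : C) : ∃ (a : Fin m → A) (d : C),
        c = ∑ j, i₁ (a j) * (i₂ t - i₁ t) ^ (j : ℕ) + d * (i₂ t - i₁ t) ^ m := by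
      induction m with
      | zero => exact ⟨Fin.elim0, c, by simp⟩
      | succ m ih =>
        obtain ⟨a, d, h⟩ := ih
        have hd : d - i₁ (δ d) ∈ Ideal.span {i₂ t - i₁ t} := by
          rw [← hδ, RingHom.mem_ker, map_sub, ← RingHom.comp_apply δ i₁, hδ₁, RingHom.id_apply,
            sub_self]
        obtain ⟨d', hd'⟩ := Ideal.mem_span_singleton.1 hd
        refine ⟨Fin.snoc a (δ d), d', ?_⟩
        rw [Fin.sum_univ_castSucc]
        simp only [Fin.snoc_castSucc, Fin.snoc_last, Fin.val_castSucc, Fin.val_last]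
        linear_combination h + (i₂ t - i₁ t) ^ m * hd'
    intro q
    obtain ⟨c, rfl⟩ := hπ q
    obtain ⟨a, d, h⟩ := hstep (k + 1) c
    refine ⟨a, ?_⟩
    have hz : π ((i₂ t - i₁ t) ^ (k + 1)) = 0 := by
      rw [← RingHom.mem_ker, hker]
      exact Ideal.mem_span_singleton_self _
    rw [h]
    simp only [map_add, map_sum, map_mul, hz, mul_zero, add_zero, map_pow]

end IsCoordinate

/-! ### Expansion of the transition functions -/

/-- The negative binomial series, truncated: up to multiples of `v ^ N`, the inverse of
`(1 - v) ^ (e + 1)` is the sum of the `(e + i).choose e * v ^ i`. -/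
lemma one_sub_pow_mul_sum_choose {R : Type*} [CommRing R] (v : R) (e N : ℕ) :
    ∃ r, (1 - v) ^ (e + 1) * ∑ i ∈ Finset.range N, ((e + i).choose e : R) * v ^ i =
      1 + r * v ^ N := by
  induction e with
  | zero =>
    refine ⟨-1, ?_⟩
    simp only [zero_add, pow_one, Nat.choose_zero_right, Nat.cast_one, one_mul]
    rw [mul_comm, geom_sum_mul_neg]
    ring
  | succ e ih =>
    have key : (1 - v) * ∑ i ∈ Finset.range N, ((e + 1 + i).choose (e + 1) : R) * v ^ i =
        ∑ i ∈ Finset.range N, ((e + i).choose e : R) * v ^ i -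
          ((e + N).choose (e + 1) : R) * v ^ N := by
      clear ih
      induction N with
      | zero => simp
      | succ N ihN =>
        rw [Finset.sum_range_succ, mul_add, ihN, Finset.sum_range_succ,
          show e + 1 + N = e + N + 1 by omega, show e + (N + 1) = e + N + 1 by omega,
          Nat.choose_succ_succ]
        push_cast
        ring
    obtain ⟨r, hr⟩ := ih
    refine ⟨r - (1 - v) ^ (e + 1) * ((e + N).choose (e + 1) : R), ?_⟩
    rw [pow_succ, mul_assoc, key, mul_sub, hr]
    ring

section Transition

variable {R : Type*} [CommRing R] (α β : ℤ[T;T⁻¹] →+* R)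

open LaurentPolynomial (T)

lemma map_T_mul (α : ℤ[T;T⁻¹] →+* R) (m n : ℤ) : α (T m) * α (T n) = α (T (m + n)) := by
  rw [← map_mul, LaurentPolynomial.T_add]

lemma map_T_neg_sub : β (T (-1)) - α (T (-1)) =
    -(α (T (-1)) * β (T (-1)) * (β (T 1) - α (T 1))) := by
  have h1 : α (T (-1)) * α (T 1) = 1 := by rw [map_T_mul]; simp
  have h2 : β (T (-1)) * β (T 1) = 1 := by rw [map_T_mul]; simp
  linear_combination α (T (-1)) * h2 - β (T (-1)) * h1

/-- With `t = α T` and `t + τ = β T`, this is the formula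
`dsᵖ (t + τ)ⁿ = (-1)ᵖ t⁻ᵖ τᵖ (t + τ)ⁿ⁻ᵖ`. -/
lemma pow_mul_map_T (n : ℤ) (p : ℕ) : (β (T (-1)) - α (T (-1))) ^ p * β (T n) =
    (-1) ^ p * α (T (-p)) * ((β (T 1) - α (T 1)) ^ p * β (T (n - p))) := by
  have h1 : α (T (-1)) ^ p = α (T (-p)) := by
    rw [← map_pow, LaurentPolynomial.T_pow]; simp
  have h2 : β (T (-1)) ^ p * β (T n) = β (T (n - p)) := by
    rw [← map_pow, LaurentPolynomial.T_pow, map_T_mul]; congr 2; ring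
  rw [map_T_neg_sub, neg_pow, mul_pow, mul_pow, h1, ← h2]
  ring

lemma pow_mul_map_T_eq_sum_of_le {n : ℤ} {p : ℕ} (h : (p : ℤ) ≤ n) :
    (β (T (-1)) - α (T (-1))) ^ p * β (T n) = ∑ j ∈ Finset.Icc p n.toNat,
      α (((-1) ^ p * ((n - p).toNat.choose (j - p) : ℤ)) • T (n - p - j)) *
        (β (T 1) - α (T 1)) ^ j := by
  obtain ⟨m, rfl⟩ : ∃ m : ℕ, n = p + m := ⟨(n - p).toNat, by omega⟩
  have hβ : β (T m) = ∑ i ∈ Finset.range (m + 1),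
      (β (T 1) - α (T 1)) ^ i * α (T (m - i)) * (m.choose i : R) := by
    have : β (T m) = ((β (T 1) - α (T 1)) + α (T 1)) ^ m := by
      rw [sub_add_cancel, ← map_pow, LaurentPolynomial.T_pow]; simp
    rw [this, add_pow]
    refine Finset.sum_congr rfl fun i hi ↦ ?_
    rw [← map_pow, LaurentPolynomial.T_pow, Nat.cast_sub (by simpa [Nat.lt_succ_iff] using hi),
      mul_one]
  rw [pow_mul_map_T, add_sub_cancel_left, hβ, Finset.mul_sum, Finset.mul_sum,
    ← Finset.Ico_add_one_right_eq_Icc, Finset.sum_Ico_eq_sum_range]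
  have hr : ((p : ℤ) + m).toNat + 1 - p = m + 1 := by omega
  rw [hr]
  refine Finset.sum_congr rfl fun i hi ↦ ?_
  rw [map_zsmul, zsmul_eq_mul, show (m : ℤ) - ((p + i : ℕ) : ℤ) = -p + (m - i) by push_cast; ring,
    ← map_T_mul, add_tsub_cancel_left, pow_add, Int.toNat_natCast]
  push_cast
  ring

lemma pow_mul_map_T_eq_sum_of_lt {n : ℤ} {p k : ℕ} (h : n < p) (hp : p ≤ k)
    (hk : (β (T 1) - α (T 1)) ^ (k + 1) = 0) :
    (β (T (-1)) - α (T (-1))) ^ p * β (T n) = ∑ j ∈ Finset.Icc p k,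
      α (((-1) ^ j * ((j - n - 1).toNat.choose (p - n - 1).toNat : ℤ)) • T (n - p - j)) *
        (β (T 1) - α (T 1)) ^ j := by
  obtain ⟨e, he⟩ : ∃ e : ℕ, n - p = -((e + 1 : ℕ) : ℤ) := ⟨(p - n - 1).toNat, by omega⟩
  obtain ⟨N, rfl⟩ : ∃ N : ℕ, k = p + N := ⟨k - p, by omega⟩
  set τ := β (T 1) - α (T 1) with hτ
  -- With `v = -τ / t` one has `t + τ = t (1 - v)`.
  set v := -α (T (-1)) * τ with hv
  have hαu : α (T 1) * α (T (-1)) = 1 := by rw [map_T_mul]; simp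
  have hv1 : β (T 1) = α (T 1) * (1 - v) := by
    linear_combination hτ - τ * hαu + α (T 1) * hv
  obtain ⟨r, hr⟩ := one_sub_pow_mul_sum_choose v e (N + 1)
  have hz : τ ^ p * v ^ (N + 1) = 0 := by
    have : τ ^ p * v ^ (N + 1) = τ ^ (p + N + 1) * (-α (T (-1))) ^ (N + 1) := by
      rw [hv, mul_pow]; ring
    rw [this, hk, zero_mul]
  have hβ : τ ^ p * β (T (n - p)) = τ ^ p * (α (T (n - p)) *
      ∑ i ∈ Finset.range (N + 1), ((e + i).choose e : R) * v ^ i) := by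
    have e1 : β (T (n - p)) * β (T 1) ^ (e + 1) = 1 := by
      rw [← map_pow, LaurentPolynomial.T_pow, map_T_mul, he]; simp
    have e2 : α (T (n - p)) * α (T 1) ^ (e + 1) = 1 := by
      rw [← map_pow, LaurentPolynomial.T_pow, map_T_mul, he]; simp
    rw [hv1, mul_pow] at e1
    set b := β (T (n - p))
    set a := α (T (n - p))
    set x := α (T 1) ^ (e + 1)
    set S := ∑ i ∈ Finset.range (N + 1), ((e + i).choose e : R) * v ^ i
    linear_combination (τ ^ p * a * S) * e1 - τ ^ p * b * (1 - v) ^ (e + 1) * S * e2 -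
      τ ^ p * b * hr - b * r * hz
  rw [pow_mul_map_T, hβ, Finset.mul_sum, Finset.mul_sum, Finset.mul_sum,
    ← Finset.Ico_add_one_right_eq_Icc, Finset.sum_Ico_eq_sum_range]
  have hr : p + N + 1 - p = N + 1 := by omega
  rw [hr]
  refine Finset.sum_congr rfl fun i hi ↦ ?_
  have c1 : (((p + i : ℕ) : ℤ) - n - 1).toNat = e + i := by omega
  have c2 : ((p : ℤ) - n - 1).toNat = e := by omega
  have c3 : α (T (-1)) ^ i = α (T (-i)) := by
    rw [← map_pow, LaurentPolynomial.T_pow]; simp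
  rw [map_zsmul, zsmul_eq_mul, show n - p - ((p + i : ℕ) : ℤ) = -p + ((n - p) + -i) by
    push_cast; ring, ← map_T_mul, ← map_T_mul, c1, c2, ← c3, hv, mul_pow,
    neg_pow]
  push_cast
  ring

end Transition

end PrincipalParts

/-! ### Functions on the infinitesimal neighbourhood of the diagonal -/

namespace PrincipalParts

section Square

variable {X : Scheme.{u}} {S : Scheme.{u}} (f : X ⟶ S) (V : X.Opens)

/-- The open subscheme `V ×_S V` of `X ×_S X`. -/
def square : (Limits.pullback f f).Opens :=
  Limits.pullback.fst f f ⁻¹ᵁ V ⊓ Limits.pullback.snd f f ⁻¹ᵁ V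

lemma square_le_fst : square f V ≤ Limits.pullback.fst f f ⁻¹ᵁ V := inf_le_left

lemma square_le_snd : square f V ≤ Limits.pullback.snd f f ⁻¹ᵁ V := inf_le_right

/-- The pullback of functions along the first projection `V ×_S V ⟶ V`. -/
def squareFst : Γ(X, V) →+* Γ(Limits.pullback f f, square f V) :=
  ((Limits.pullback.fst f f).appLE V (square f V) (square_le_fst f V)).hom

/-- The pullback of functions along the second projection `V ×_S V ⟶ V`. -/
def squareSnd : Γ(X, V) →+* Γ(Limits.pullback f f, square f V) :=
  ((Limits.pullback.snd f f).appLE V (square f V) (square_le_snd f V)).hom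

lemma diagonal_preimage_square : Limits.pullback.diagonal f ⁻¹ᵁ square f V = V := by
  change Limits.pullback.diagonal f ⁻¹ᵁ (Limits.pullback.fst f f ⁻¹ᵁ V) ⊓
    Limits.pullback.diagonal f ⁻¹ᵁ (Limits.pullback.snd f f ⁻¹ᵁ V) = V
  rw [← Scheme.Hom.comp_preimage, ← Scheme.Hom.comp_preimage]
  simp

/-- The restriction of functions on `V ×_S V` to the diagonal. -/
def squareDiag : Γ(Limits.pullback f f, square f V) →+* Γ(X, V) :=
  ((Limits.pullback.diagonal f).appLE (square f V) V (diagonal_preimage_square f V).ge).hom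

lemma id_appLE {X : Scheme.{u}} {V : X.Opens} (h : V ≤ 𝟙 X ⁻¹ᵁ V) :
    (𝟙 X :).appLE V V h = 𝟙 _ :=
  ((𝟙 X :).appLE_eq_app (U := V)).trans (Scheme.Hom.id_app V)

lemma squareDiag_comp_squareFst : (squareDiag f V).comp (squareFst f V) = RingHom.id _ := by
  rw [squareDiag, squareFst, ← CommRingCat.hom_comp, Scheme.Hom.appLE_comp_appLE]
  simp only [Limits.pullback.diagonal_fst, id_appLE, CommRingCat.hom_id]

lemma squareDiag_comp_squareSnd : (squareDiag f V).comp (squareSnd f V) = RingHom.id _ := by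
  rw [squareDiag, squareSnd, ← CommRingCat.hom_comp, Scheme.Hom.appLE_comp_appLE]
  simp only [Limits.pullback.diagonal_snd, id_appLE, CommRingCat.hom_id]

lemma ker_appLE_of_eq {X Y : Scheme.{u}} (g : X ⟶ Y) {W : Y.Opens} {V : X.Opens}
    (h : V = g ⁻¹ᵁ W) : RingHom.ker (g.appLE W V h.le).hom = RingHom.ker (g.app W).hom := by
  subst h
  rw [Scheme.Hom.appLE_eq_app]

lemma isAffineOpen_square [IsAffine S] {V : X.Opens} (hV : IsAffineOpen V) :
    IsAffineOpen (square f V) := by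
  have : IsAffine _ := hV
  have : IsAffine _ := isAffineOpen_top S
  exact .of_isIso (Scheme.Hom.isPullback_resLE (US := ⊤) (IsPullback.of_hasPullback f f)
    le_top le_top (UY := square f V) rfl).isoPullback.hom

lemma isPushout_square [IsAffine S] {V : X.Opens} (hV : IsAffineOpen V) :
    IsPushout (f.appLE ⊤ V le_top) (f.appLE ⊤ V le_top)
      (CommRingCat.ofHom (squareFst f V)) (CommRingCat.ofHom (squareSnd f V)) :=
  (isIso_pushoutSection_iff (IsPullback.of_hasPullback f f) (US := ⊤) (UT := V) (UX := V)
    (UY := square f V) le_top le_top rfl).1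
    (isIso_pushoutSection_of_isAffineOpen _ le_top le_top rfl (isAffineOpen_top S) hV hV)

variable [IsSeparated f] (k : ℕ)

lemma preimage_eq_preimage_square : p f k ⁻¹ᵁ V = diagNhdι f k ⁻¹ᵁ square f V := by
  change p f k ⁻¹ᵁ V = p f k ⁻¹ᵁ V ⊓ q f k ⁻¹ᵁ V
  exact (inf_eq_left.2 (preimage_le f k V)).symm

/-- The restriction of functions on `V ×_S V` to the infinitesimal neighbourhood. -/
def squareToNhd : Γ(Limits.pullback f f, square f V) →+* Γ(diagNhd f k, p f k ⁻¹ᵁ V) :=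
  ((diagNhdι f k).appLE (square f V) (p f k ⁻¹ᵁ V) (preimage_eq_preimage_square f V k).le).hom

lemma squareToNhd_squareFst (a : Γ(X, V)) :
    squareToNhd f V k (squareFst f V a) = (p f k).app V a := by
  rw [squareToNhd, squareFst, ← CommRingCat.comp_apply, Scheme.Hom.appLE_comp_appLE,
    ← Scheme.Hom.appLE_eq_app]
  rfl

/-- The pullback of functions along the second projection `q`, restricted to `p⁻¹ V ≤ q⁻¹ V`. -/
def qApp : Γ(X, V) →+* Γ(diagNhd f k, p f k ⁻¹ᵁ V) :=
  ((q f k).appLE V (p f k ⁻¹ᵁ V) (preimage_le f k V)).hom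

lemma squareToNhd_squareSnd (a : Γ(X, V)) :
    squareToNhd f V k (squareSnd f V a) = qApp f V k a := by
  rw [squareToNhd, squareSnd, ← CommRingCat.comp_apply, Scheme.Hom.appLE_comp_appLE]
  rfl

lemma diff_eq (a : Γ(X, V)) : diff f k a = qApp f V k a - (p f k).app V a := rfl

lemma squareToNhd_sub (a : Γ(X, V)) :
    squareToNhd f V k (squareSnd f V a - squareFst f V a) = diff f k a := by
  rw [map_sub, squareToNhd_squareFst, squareToNhd_squareSnd, diff_eq]

lemma appLE_surjective_of_eq {X Y : Scheme.{u}} (g : X ⟶ Y) {W : Y.Opens} {V : X.Opens}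
    (h : V = g ⁻¹ᵁ W) (hg : Function.Surjective (g.app W)) :
    Function.Surjective (g.appLE W V h.le) := by
  subst h
  rwa [Scheme.Hom.appLE_eq_app]

variable [IsAffine S] {V}

lemma squareToNhd_surjective (hV : IsAffineOpen V) :
    Function.Surjective (squareToNhd f V k) :=
  appLE_surjective_of_eq (diagNhdι f k) (preimage_eq_preimage_square f V k)
    (Scheme.IdealSheafData.subschemeι_app_surjective _ ⟨_, isAffineOpen_square f hV⟩)

lemma ker_squareToNhd (hV : IsAffineOpen V) :
    RingHom.ker (squareToNhd f V k) = RingHom.ker (squareDiag f V) ^ (k + 1) := by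
  rw [squareToNhd, ker_appLE_of_eq _ (preimage_eq_preimage_square f V k), squareDiag,
    ker_appLE_of_eq _ (diagonal_preimage_square f V).symm]
  refine (Scheme.IdealSheafData.ker_subschemeι_app _ ⟨_, isAffineOpen_square f hV⟩).trans ?_
  rw [Scheme.IdealSheafData.ideal_pow, Pi.pow_apply, Scheme.Hom.ker_apply]

lemma diff_pow_eq_zero (hV : IsAffineOpen V) (a : Γ(X, V)) : diff f k a ^ (k + 1) = 0 := by
  rw [← squareToNhd_sub, ← map_pow, ← RingHom.mem_ker, ker_squareToNhd f k hV]
  refine Ideal.pow_mem_pow ?_ _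
  rw [RingHom.mem_ker, map_sub, ← RingHom.comp_apply, ← RingHom.comp_apply,
    squareDiag_comp_squareFst, squareDiag_comp_squareSnd, sub_self]

end Square

/-! ### Bases of the modules of principal parts -/

section Basis

variable {X : Scheme.{0}} (f : X ⟶ Spec (.of ℤ)) [IsSeparated f] (k : ℕ) {V : X.Opens}

lemma specZ_hom_ext {B : CommRingCat.{0}} (g h : Γ(Spec (.of ℤ), ⊤) ⟶ B) : g = h := by
  rw [← cancel_epi (Scheme.ΓSpecIso (.of ℤ)).inv]
  ext : 1
  exact Subsingleton.elim (α := ℤ →+* B) _ _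

/-- The functions on `p⁻¹ V ⊆ Δᵏ` are free over `Γ(X, V)` on the powers of `dt`. -/
lemma bijective_sum_diff_pow (hV : IsAffineOpen V) {t : Γ(X, V)} (ht : IsCoordinate t) :
    Function.Bijective fun a : Fin (k + 1) → Γ(X, V) ↦
      ∑ j, (p f k).app V (a j) * diff f k t ^ (j : ℕ) := by
  have hpush := isPushout_square f hV
  have := ht.bijective_sum k (i₁ := squareFst f V) (i₂ := squareSnd f V) (δ := squareDiag f V)
    (π := squareToNhd f V k) ?_ ?_ (squareDiag_comp_squareFst f V) (squareDiag_comp_squareSnd f V)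
    (squareToNhd_surjective f k hV) (ker_squareToNhd f k hV)
  · simpa only [squareToNhd_squareFst, squareToNhd_sub] using this
  · intro B _ g h h₁ h₂
    have : CommRingCat.ofHom g = CommRingCat.ofHom h :=
      hpush.hom_ext (CommRingCat.hom_ext h₁) (CommRingCat.hom_ext h₂)
    exact congr(($this).hom)
  · intro B _ a b
    refine ⟨(hpush.desc (CommRingCat.ofHom a) (CommRingCat.ofHom b)
      (specZ_hom_ext _ _)).hom, ?_, ?_⟩
    · exact congr($(hpush.inl_desc (CommRingCat.ofHom a) (CommRingCat.ofHom b)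
        (specZ_hom_ext _ _)).hom)
    · exact congr($(hpush.inr_desc (CommRingCat.ofHom a) (CommRingCat.ofHom b)
        (specZ_hom_ext _ _)).hom)

lemma trivializes_oneTmul {E : X.Modules} {e : Γ(E, V)} (he : E.Trivializes e) :
    ((Scheme.Modules.pullback (q f k)).obj E).Trivializes (U := p f k ⁻¹ᵁ V) (oneTmul k e) :=
  (he.pullback (q f k)).map (preimage_le f k V)

/-- A function on `V` acts on principal parts via `p`, so that a left linear combination of the
`dtʲ ⊗ e` is a function on `p⁻¹ V` times `1 ⊗ e`. -/
lemma sum_smul_dPow {E : X.Modules} {ι : Type*} (s : Finset ι) (t : Γ(X, V)) (e : Γ(E, V))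
    (a : ι → Γ(X, V)) (m : ι → ℕ) :
    ∑ j ∈ s, a j • dPow f k t (m j) e =
      ((∑ j ∈ s, (p f k).app V (a j) * diff f k t ^ m j) • oneTmul k e :
        Γ((Scheme.Modules.pullback (q f k)).obj E, p f k ⁻¹ᵁ V)) := by
  rw [Finset.sum_smul]
  simp only [mul_smul]
  rfl

/-- For a coordinate `t` on the affine open `V` and a section `e` trivializing `E` over `V`, the
sections `dtʲ ⊗ e` with `j ≤ k` form a basis of the left module of principal parts over `V`. -/
theorem exists_basis_dPow {E : X.Modules} (hV : IsAffineOpen V) {t : Γ(X, V)}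
    (ht : IsCoordinate t) {e : Γ(E, V)} (he : E.Trivializes e) :
    ∃ B : Module.Basis (Fin (k + 1)) Γ(X, V) Γ(principalParts f k E, V),
      ∀ j, B j = dPow f k t j e := by
  let Φ : (Fin (k + 1) → Γ(X, V)) →ₗ[Γ(X, V)] Γ(principalParts f k E, V) :=
    Fintype.linearCombination Γ(X, V) fun j : Fin (k + 1) ↦ dPow f k t j e
  have hΦ : Function.Bijective Φ := by
    have h := ((trivializes_oneTmul f k he) _ le_rfl).comp (bijective_sum_diff_pow f k hV ht)
    have hΦ' : ⇑Φ = _ := funext fun a ↦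
      (sum_smul_dPow f k Finset.univ t e a fun j ↦ j).trans
        (congrArg _ (Scheme.Modules.map_self (oneTmul k e)).symm)
    exact hΦ' ▸ h
  refine ⟨.ofEquivFun (LinearEquiv.ofBijective Φ hΦ).symm, fun j ↦ ?_⟩
  rw [Module.Basis.coe_ofEquivFun]
  simp [Φ]

lemma oneTmul_smul {E : X.Modules} (r : Γ(X, V)) (e : Γ(E, V)) :
    oneTmul k (r • e) = (qApp f V k r • oneTmul k e :
      Γ((Scheme.Modules.pullback (q f k)).obj E, p f k ⁻¹ᵁ V)) := by
  unfold oneTmul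
  rw [Scheme.Modules.Hom.app_smul]
  exact Scheme.Modules.map_smul _ _ _ _

lemma map_oneTmul {E : X.Modules} {U : X.Opens} (h : U ≤ V) (e : Γ(E, V)) :
    ((Scheme.Modules.pullback (q f k)).obj E).presheaf.map
      (homOfLE ((p f k).preimage_mono h)).op (oneTmul k e) =
        oneTmul k (E.presheaf.map (homOfLE h).op e) := by
  refine (Scheme.Modules.map_map _ _ _).trans ?_
  refine (Scheme.Modules.map_map (M := (Scheme.Modules.pullback (q f k)).obj E)
    ((q f k).preimage_mono h) (preimage_le f k U) _).symm.trans ?_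
  exact congrArg (((Scheme.Modules.pullback (q f k)).obj E).presheaf.map
      (homOfLE (preimage_le f k U)).op) (Scheme.Modules.app_map
    ((Scheme.Modules.pullbackPushforwardAdjunction (q f k)).unit.app E) h e).symm

lemma map_diff {U : X.Opens} (h : U ≤ V) (a : Γ(X, V)) :
    (diagNhd f k).presheaf.map (homOfLE ((p f k).preimage_mono h)).op (diff f k a) =
      diff f k (X.presheaf.map (homOfLE h).op a) := by
  rw [diff_eq, diff_eq, map_sub]
  congr 1
  · rw [qApp, qApp, ← CommRingCat.comp_apply, ← CommRingCat.comp_apply, Scheme.Hom.appLE_map,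
      Scheme.Hom.map_appLE]
  · exact congr($((p f k).naturality (homOfLE h).op) a).symm

lemma map_dPow {E : X.Modules} {U : X.Opens} (h : U ≤ V) (a : Γ(X, V)) (j : ℕ) (e : Γ(E, V)) :
    (principalParts f k E).presheaf.map (homOfLE h).op (dPow f k a j e) =
      dPow f k (X.presheaf.map (homOfLE h).op a) j (E.presheaf.map (homOfLE h).op e) := by
  unfold dPow
  refine (Scheme.Modules.map_smul _ (homOfLE ((p f k).preimage_mono h)) _ _).trans ?_
  rw [map_pow, map_diff, map_oneTmul]

end Basis

end PrincipalParts

/-! ### Functions and twisting sheaves on `Proj` -/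

namespace ProjTwist

variable {σ : Type*} {A : Type u} [CommRing A] [SetLike σ A] [AddSubgroupClass σ A]
variable (𝒜 : ℕ → σ) [GradedRing 𝒜]

/-- The value of a regular function at the point `x`, in the localization of the graded ring. -/
def evalAt {V : (Proj 𝒜).Opens} (x : ProjectiveSpectrum 𝒜) (hx : (x : Proj 𝒜) ∈ V) :
    Γ(Proj 𝒜, V) →+* Loc 𝒜 x :=
  (algebraMap (HomogeneousLocalization.AtPrime 𝒜 x.asHomogeneousIdeal.toIdeal)
    (Loc 𝒜 x)).comp (openToLocalization 𝒜 V x hx).hom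

/-- The value of a section of `𝒪(n)` at the point `x`, in the localization of the graded ring. -/
def sectionAt {n : ℤ} {V : (Proj 𝒜).Opens} (m : Γ(twist 𝒜 n, V)) (x : ProjectiveSpectrum 𝒜)
    (hx : (x : Proj 𝒜) ∈ V) : Loc 𝒜 x :=
  (show (sheafInType 𝒜 n).1.obj (op V) from m).1 ⟨x, hx⟩

variable {𝒜}

lemma evalAt_ext {V : (Proj 𝒜).Opens} {r r' : Γ(Proj 𝒜, V)}
    (h : ∀ (x : ProjectiveSpectrum 𝒜) (hx : (x : Proj 𝒜) ∈ V),
      evalAt 𝒜 x hx r = evalAt 𝒜 x hx r') : r = r' :=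
  Proj.ext 𝒜 (V := op V) r r'
    (funext fun x ↦ HomogeneousLocalization.val_injective _ (h x.1 x.2))

lemma sectionAt_ext {n : ℤ} {V : (Proj 𝒜).Opens} {m m' : Γ(twist 𝒜 n, V)}
    (h : ∀ (x : ProjectiveSpectrum 𝒜) (hx : (x : Proj 𝒜) ∈ V),
      sectionAt 𝒜 m x hx = sectionAt 𝒜 m' x hx) : m = m' :=
  Subtype.ext (funext fun x ↦ h x.1 x.2)

lemma sectionAt_smul {n : ℤ} {V : (Proj 𝒜).Opens} (r : Γ(Proj 𝒜, V)) (m : Γ(twist 𝒜 n, V))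
    (x : ProjectiveSpectrum 𝒜) (hx : (x : Proj 𝒜) ∈ V) :
    sectionAt 𝒜 (r • m) x hx = evalAt 𝒜 x hx r * sectionAt 𝒜 m x hx := rfl

lemma sectionAt_map {n : ℤ} {V W : (Proj 𝒜).Opens} (h : W ≤ V) (m : Γ(twist 𝒜 n, V))
    (x : ProjectiveSpectrum 𝒜) (hx : (x : Proj 𝒜) ∈ W) :
    sectionAt 𝒜 ((twist 𝒜 n).presheaf.map (homOfLE h).op m) x hx = sectionAt 𝒜 m x (h hx) := rfl

lemma evalAt_ratio {a f : A} (ha : a ∈ 𝒜 1) (hf : f ∈ 𝒜 1) (x : ProjectiveSpectrum 𝒜)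
    (hx : (x : Proj 𝒜) ∈ Proj.basicOpen 𝒜 f) :
    evalAt 𝒜 x hx (ratio 𝒜 ha hf) = Localization.mk a ⟨f, hx⟩ := by
  have h := ProjectiveSpectrum.Proj.awayToSection_apply 𝒜 f
    (HomogeneousLocalization.Away.mk 𝒜 hf 1 a (by simpa using ha)) ⟨x, hx⟩
  refine Eq.trans h ?_
  rw [HomogeneousLocalization.Away.val_mk, Localization.mk_eq_mk', IsLocalization.map_mk',
    Localization.mk_eq_mk']
  simp

lemma evalAt_ratio_mul {a f : A} (ha : a ∈ 𝒜 1) (hf : f ∈ 𝒜 1) (x : ProjectiveSpectrum 𝒜)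
    (hx : (x : Proj 𝒜) ∈ Proj.basicOpen 𝒜 f) :
    evalAt 𝒜 x hx (ratio 𝒜 ha hf) * algebraMap A (Loc 𝒜 x) f = algebraMap A (Loc 𝒜 x) a := by
  rw [evalAt_ratio, Localization.mk_eq_mk']
  exact IsLocalization.mk'_spec _ _ _

lemma isUnit_germ_iff {V : (Proj 𝒜).Opens} (r : Γ(Proj 𝒜, V)) (x : ProjectiveSpectrum 𝒜)
    (hx : (x : Proj 𝒜) ∈ V) :
    IsUnit ((Proj 𝒜).presheaf.germ V x hx r) ↔ IsUnit (evalAt 𝒜 x hx r) := by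
  refine (MulEquiv.isUnit_map (Proj.stalkIso' 𝒜 x)).symm.trans ?_
  refine (Iff.of_eq (congrArg IsUnit (Proj.stalkIso'_germ 𝒜 V x hx r))).trans ?_
  exact (HomogeneousLocalization.isUnit_iff_isUnit_val (𝒜 := 𝒜) x.asHomogeneousIdeal.toIdeal _).symm

lemma basicOpen_ratio {a f : A} (ha : a ∈ 𝒜 1) (hf : f ∈ 𝒜 1) :
    (Proj 𝒜).basicOpen (ratio 𝒜 ha hf) = Proj.basicOpen 𝒜 f ⊓ Proj.basicOpen 𝒜 a := by
  have key (x : ProjectiveSpectrum 𝒜) (hx : (x : Proj 𝒜) ∈ Proj.basicOpen 𝒜 f) :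
      (x : Proj 𝒜) ∈ (Proj 𝒜).basicOpen (ratio 𝒜 ha hf) ↔
        (x : Proj 𝒜) ∈ Proj.basicOpen 𝒜 a := by
    refine (Scheme.mem_basicOpen _ _ _ hx).trans ((isUnit_germ_iff _ x hx).trans ?_)
    rw [evalAt_ratio, Localization.mk_eq_mk']
    exact IsLocalization.AtPrime.isUnit_mk'_iff _ _ _ _
  ext x
  constructor
  · intro hx
    have hxf : x ∈ Proj.basicOpen 𝒜 f := (Proj 𝒜).basicOpen_le _ hx
    exact ⟨hxf, (key x hxf).1 hx⟩
  · intro hx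
    exact (key x hx.1).2 hx.2

/-- A product of fractions of opposite degrees is a fraction of homogeneous elements of the same
degree. -/
lemma exists_mk_eq {m n : ℤ} (hmn : m + n = 0) {U : Opens (ProjectiveSpectrum.top 𝒜)}
    {g h : ∀ x : U, Loc 𝒜 x.1} (hg : IsFraction 𝒜 m g) (hh : IsFraction 𝒜 n h) :
    ∃ (d : ℕ) (a b : 𝒜 d) (hb : ∀ x : U, (b : A) ∉ x.1.asHomogeneousIdeal.toIdeal),
      ∀ x : U, g x * h x = Localization.mk (a : A) ⟨(b : A), hb x⟩ := by
  obtain ⟨d, a, b, hb, ha, hU, w⟩ := hg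
  obtain ⟨d', a', b', hb', ha', hU', w'⟩ := hh
  have haa : a * a' ∈ 𝒜 (d + d') := by
    rcases ha with rfl | ⟨i, hi, ha⟩
    · rw [zero_mul]; exact zero_mem _
    rcases ha' with rfl | ⟨i', hi', ha'⟩
    · rw [mul_zero]; exact zero_mem _
    have : d + d' = i + i' := by omega
    rw [this]
    exact SetLike.mul_mem_graded ha ha'
  refine ⟨d + d', ⟨_, haa⟩, ⟨b * b', SetLike.mul_mem_graded hb hb'⟩,
    fun x ↦ mul_notMem 𝒜 x.1 (hU x) (hU' x), fun x ↦ ?_⟩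
  rw [w, w', Localization.mk_mul]
  rfl

lemma IsFraction.res {n : ℤ} {U V : Opens (ProjectiveSpectrum.top 𝒜)} (i : V ⟶ U)
    {g : ∀ x : U, Loc 𝒜 x.1} (hg : IsFraction 𝒜 n g) :
    IsFraction 𝒜 n fun x : V ↦ g (i x) :=
  (isFractionPrelocal 𝒜 n).res i g hg

/-- Functions with values in the localizations that are locally homogeneous fractions of degree
zero are regular. -/
lemma exists_evalAt_eq {V : (Proj 𝒜).Opens}
    (z : ∀ (x : ProjectiveSpectrum 𝒜) (_ : (x : Proj 𝒜) ∈ V), Loc 𝒜 x)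
    (hz : ∀ (x : ProjectiveSpectrum 𝒜) (_ : (x : Proj 𝒜) ∈ V),
      ∃ (W : Opens (ProjectiveSpectrum.top 𝒜)) (_ : x ∈ W) (i : W ⟶ V)
        (d : ℕ) (a b : 𝒜 d) (hb : ∀ y : W, (b : A) ∉ y.1.asHomogeneousIdeal.toIdeal),
        ∀ y : W, z y.1 (leOfHom i y.2) = Localization.mk (a : A) ⟨(b : A), hb y⟩) :
    ∃ r : Γ(Proj 𝒜, V), ∀ (x : ProjectiveSpectrum 𝒜) (hx : (x : Proj 𝒜) ∈ V),
      evalAt 𝒜 x hx r = z x hx := by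
  have hval (x : ProjectiveSpectrum 𝒜) (hx : (x : Proj 𝒜) ∈ V) :
      ∃ w : HomogeneousLocalization.AtPrime 𝒜 x.asHomogeneousIdeal.toIdeal, w.val = z x hx := by
    obtain ⟨W, hW, i, d, a, b, hb, w⟩ := hz x hx
    exact ⟨.mk ⟨d, a, b, hb ⟨x, hW⟩⟩, (HomogeneousLocalization.val_mk _).trans (w ⟨x, hW⟩).symm⟩
  choose w hw using hval
  have hmem : (ProjectiveSpectrum.StructureSheaf.isLocallyFraction 𝒜).pred
      (U := V) fun x ↦ w x.1 x.2 := by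
    intro x
    obtain ⟨W, hW, i, d, a, b, hb, h⟩ := hz x.1 x.2
    refine ⟨W, hW, i, d, a, b, hb, fun y ↦ HomogeneousLocalization.val_injective _ ?_⟩
    refine (hw _ _).trans ((h y).trans ?_)
    exact (HomogeneousLocalization.val_mk (𝒜 := 𝒜)
      (x := (show ProjectiveSpectrum 𝒜 from y.1).asHomogeneousIdeal.toIdeal.primeCompl)
      ⟨d, a, b, hb y⟩).symm
  exact ⟨(⟨_, hmem⟩ :
    (ProjectiveSpectrum.StructureSheaf.structureSheafInType 𝒜).1.obj (op V)), hw⟩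

/-- For `f` of degree one, `fⁿ` trivializes `𝒪(n)` over `D₊(f)`, as division by `fⁿ` turns a section
of `𝒪(n)` into a function. -/
lemma trivializes_powSection {f : A} (hf : f ∈ 𝒜 1) (n : ℤ) :
    (twist 𝒜 n).Trivializes (powSection 𝒜 hf n) := by
  intro V hV
  have hat (x : ProjectiveSpectrum 𝒜) (hx : (x : Proj 𝒜) ∈ V) :
      sectionAt 𝒜 ((twist 𝒜 n).presheaf.map (homOfLE hV).op (powSection 𝒜 hf n)) x hx =
        (unitAt 𝒜 f x (hV hx) ^ n : (Loc 𝒜 x)ˣ) := rfl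
  constructor
  · intro r r' h
    refine evalAt_ext fun x hx ↦ ?_
    have h' := congr(sectionAt 𝒜 $h x hx)
    rw [sectionAt_smul, sectionAt_smul, hat] at h'
    exact (Units.mul_left_inj _).1 h'
  · intro m
    have hloc (x : ProjectiveSpectrum 𝒜) (hx : (x : Proj 𝒜) ∈ V) :
        ∃ (W : Opens (ProjectiveSpectrum.top 𝒜)) (_ : x ∈ W) (i : W ⟶ V)
        (d : ℕ) (a b : 𝒜 d) (hb : ∀ y : W, (b : A) ∉ y.1.asHomogeneousIdeal.toIdeal),
        ∀ y : W, sectionAt 𝒜 m y.1 (leOfHom i y.2) *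
            ((unitAt 𝒜 f y.1 (hV (leOfHom i y.2)) ^ (-n) : (Loc 𝒜 y.1)ˣ) : Loc 𝒜 y.1) =
          Localization.mk (a : A) ⟨(b : A), hb y⟩ := by
      obtain ⟨W, hW, i, hm⟩ := (show (sheafInType 𝒜 n).1.obj (op V) from m).2 ⟨x, hx⟩
      exact ⟨W, hW, i, exists_mk_eq (add_neg_cancel n) hm
        ((unitAt_zpow_isFraction 𝒜 hf (-n)).res (i ≫ homOfLE hV))⟩
    obtain ⟨r, hr⟩ := exists_evalAt_eq (fun x hx ↦
      sectionAt 𝒜 m x hx * ((unitAt 𝒜 f x (hV hx) ^ (-n) : (Loc 𝒜 x)ˣ) : Loc 𝒜 x)) hloc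
    refine ⟨r, sectionAt_ext fun x hx ↦ ?_⟩
    dsimp only
    rw [sectionAt_smul, hat, hr, mul_assoc, ← Units.val_mul, ← zpow_add, neg_add_cancel, zpow_zero,
      Units.val_one, mul_one]

end ProjTwist

/-! ### The projective line over the integers -/

namespace P1Z

open PrincipalParts ProjTwist

/-- The grading of `ℤ[x₀, x₁]` by degree. -/
abbrev grading : ℕ → Submodule ℤ (MvPolynomial (Fin 2) ℤ) :=
  MvPolynomial.homogeneousSubmodule (Fin 2) ℤ

/-- The element `xⱼ / xᵢ` of `ℤ[x₀, x₁]_(xᵢ)`. -/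
def awayRatio (i j : Fin 2) : HomogeneousLocalization.Away grading (MvPolynomial.X i) :=
  HomogeneousLocalization.Away.mk grading (X_mem i) 1 (MvPolynomial.X j) (by simpa using X_mem j)

lemma val_awayRatio (i j : Fin 2) :
    (awayRatio i j).val * algebraMap (MvPolynomial (Fin 2) ℤ) _ (MvPolynomial.X i) =
      algebraMap (MvPolynomial (Fin 2) ℤ) (Localization.Away (MvPolynomial.X i))
        (MvPolynomial.X j) := by
  rw [awayRatio, HomogeneousLocalization.Away.val_mk, Localization.mk_eq_mk']
  simp only [pow_one]
  exact IsLocalization.mk'_spec _ _ (⟨_, 1, pow_one _⟩ : Submonoid.powers (MvPolynomial.X i))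

/-- A homogeneous polynomial scales by `cⁿ` when its variables are scaled by `c`. -/
lemma eval₂Hom_mul_of_isHomogeneous {τ R : Type*} [CommRing R] {a : MvPolynomial τ ℤ} {n : ℕ}
    (ha : a.IsHomogeneous n) (c : R) (z : τ → R) :
    MvPolynomial.eval₂Hom (Int.castRingHom R) (fun l ↦ z l * c) a =
      MvPolynomial.eval₂Hom (Int.castRingHom R) z a * c ^ n := by
  rw [MvPolynomial.coe_eval₂Hom, MvPolynomial.coe_eval₂Hom, MvPolynomial.eval₂_eq,
    MvPolynomial.eval₂_eq, Finset.sum_mul]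
  refine Finset.sum_congr rfl fun d hd ↦ ?_
  simp only [mul_pow, Finset.prod_mul_distrib]
  rw [Finset.prod_pow_eq_pow_sum, mul_assoc]
  congr 3
  have := ha (MvPolynomial.mem_support_iff.1 hd)
  rw [← this, Finsupp.weight_apply, Finsupp.sum]
  simp

/-- The ring homomorphism `ℤ[X] →+* ℤ[x₀, x₁]_(xᵢ)` sending `X` to `xⱼ / xᵢ`. -/
def polyToAway (i j : Fin 2) :
    Polynomial ℤ →+* HomogeneousLocalization.Away grading (MvPolynomial.X i) :=
  Polynomial.eval₂RingHom (Int.castRingHom _) (awayRatio i j)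

lemma polyToAway_X (i j : Fin 2) : polyToAway i j Polynomial.X = awayRatio i j :=
  Polynomial.eval₂_X _ _

lemma polyToAway_bijective {i j : Fin 2} (hij : i ≠ j) :
    Function.Bijective (polyToAway i j) := by
  -- Dehomogenization: set `xᵢ = 1` and `xⱼ = X`.
  let g : MvPolynomial (Fin 2) ℤ →+* Polynomial ℤ :=
    MvPolynomial.eval₂Hom (Int.castRingHom _) fun l ↦ if l = i then 1 else Polynomial.X
  have hgi : g (MvPolynomial.X i) = 1 := by simp [g]
  have hgj : g (MvPolynomial.X j) = Polynomial.X := by simp [g, hij.symm]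
  constructor
  · have hg : IsUnit (g (MvPolynomial.X i)) := hgi ▸ isUnit_one
    let G : Localization.Away (MvPolynomial.X (R := ℤ) i) →+* Polynomial ℤ :=
      IsLocalization.Away.lift (MvPolynomial.X i) hg
    have hG (x) : G (algebraMap _ _ x) = g x := IsLocalization.Away.lift_eq _ hg x
    have hX : G (awayRatio i j).val = Polynomial.X := by
      have := congrArg G (val_awayRatio i j)
      rwa [map_mul, hG, hG, hgi, hgj, mul_one] at this
    let K : HomogeneousLocalization.Away grading (MvPolynomial.X i) →+* Polynomial ℤ :=
      G.comp (algebraMap _ (Localization.Away (MvPolynomial.X (R := ℤ) i)))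
    have hK : K.comp (polyToAway i j) = RingHom.id _ := by
      refine Polynomial.ringHom_ext' (Subsingleton.elim _ _) ?_
      rw [RingHom.comp_apply, polyToAway_X]
      exact hX
    exact Function.LeftInverse.injective (g := K) fun p ↦ congr($hK p)
  · intro x
    obtain ⟨n, a, ha, rfl⟩ := HomogeneousLocalization.Away.mk_surjective grading (X_mem i) x
    have ha' : a.IsHomogeneous n := by simpa using ha
    refine ⟨g a, HomogeneousLocalization.val_injective _ ?_⟩
    let v : HomogeneousLocalization.Away grading (MvPolynomial.X i) →+*
        Localization.Away (MvPolynomial.X (R := ℤ) i) := algebraMap _ _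
    have h1 : (v.comp (polyToAway i j)).comp g =
        MvPolynomial.eval₂Hom (Int.castRingHom _) fun l ↦ v (awayRatio i l) := by
      refine MvPolynomial.ringHom_ext' (Subsingleton.elim _ _) fun l ↦ ?_
      rw [MvPolynomial.eval₂Hom_X']
      by_cases hl : l = i
      · subst hl
        rw [RingHom.comp_apply, hgi, map_one]
        have hu : IsUnit (algebraMap (MvPolynomial (Fin 2) ℤ)
          (Localization.Away (MvPolynomial.X (R := ℤ) l)) (MvPolynomial.X l)) :=
          IsLocalization.Away.algebraMap_isUnit _
        exact (hu.mul_right_cancel ((val_awayRatio l l).trans (one_mul _).symm)).symm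
      · obtain rfl : l = j := by omega
        rw [RingHom.comp_apply, hgj, RingHom.comp_apply, polyToAway_X]
    have h2 : MvPolynomial.eval₂Hom (Int.castRingHom _) (fun l ↦ v (awayRatio i l) *
        algebraMap (MvPolynomial (Fin 2) ℤ) _ (MvPolynomial.X i)) =
        algebraMap (MvPolynomial (Fin 2) ℤ) (Localization.Away (MvPolynomial.X i)) := by
      refine MvPolynomial.ringHom_ext' (Subsingleton.elim _ _) fun l ↦ ?_
      rw [MvPolynomial.eval₂Hom_X']
      exact val_awayRatio i l
    rw [HomogeneousLocalization.Away.val_mk, Localization.mk_eq_mk',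
      IsLocalization.eq_mk'_iff_mul_eq]
    simp only [map_pow]
    change (v.comp (polyToAway i j)).comp g a * _ = _
    rw [h1, ← eval₂Hom_mul_of_isHomogeneous ha', h2]

/-- The isomorphism of `ℤ[X]` with `ℤ[x₀, x₁]_(xᵢ)` sending `X` to `xⱼ / xᵢ`. -/
def polyEquiv {i j : Fin 2} (hij : i ≠ j) :
    Polynomial ℤ ≃+* HomogeneousLocalization.Away grading (MvPolynomial.X i) :=
  RingEquiv.ofBijective (polyToAway i j) (polyToAway_bijective hij)

/-- The isomorphism of `ℤ[X]` with `Γ(ℙ¹, Uᵢ)` sending `X` to `xⱼ / xᵢ`. -/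
def sectionsEquiv {i j : Fin 2} (hij : i ≠ j) : Polynomial ℤ ≃+* Γ(P1, U i) :=
  (polyEquiv hij).trans
    (Proj.basicOpenIsoAway grading _ (X_mem i) one_pos).commRingCatIsoToRingEquiv

lemma sectionsEquiv_X {i j : Fin 2} (hij : i ≠ j) :
    sectionsEquiv hij Polynomial.X = ratio grading (X_mem j) (X_mem i) := by
  have : polyEquiv hij Polynomial.X = awayRatio i j := polyToAway_X i j
  rw [sectionsEquiv, RingEquiv.trans_apply, this]
  rfl

lemma isCoordinate_t : IsCoordinate t := by
  have := IsCoordinate.polynomial_X.map_equiv (sectionsEquiv (i := 0) (j := 1) (by decide))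
  rwa [sectionsEquiv_X] at this

lemma isCoordinate_s : IsCoordinate s := by
  have := IsCoordinate.polynomial_X.map_equiv (sectionsEquiv (i := 1) (j := 0) (by decide))
  rwa [sectionsEquiv_X] at this

lemma t01_mul_s01 : t01 * s01 = 1 := by
  refine evalAt_ext fun x hx ↦ ?_
  have h1 := evalAt_ratio_mul (X_mem 1) (X_mem 0) x hx.1
  have h2 := evalAt_ratio_mul (X_mem 0) (X_mem 1) x hx.2
  have hu : IsUnit (algebraMap (MvPolynomial (Fin 2) ℤ) (Loc grading x) (MvPolynomial.X 0)) :=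
    (unitAt grading _ x hx.1).isUnit
  rw [map_mul, map_one]
  refine hu.mul_right_cancel ?_
  change evalAt grading x hx.1 t * evalAt grading x hx.2 s * _ = _
  change evalAt grading x hx.1 t * _ = _ at h1
  change evalAt grading x hx.2 s * _ = _ at h2
  rw [one_mul, mul_right_comm, h1, mul_comm, h2]

lemma isAffineOpen_U (i : Fin 2) : IsAffineOpen (U i) :=
  Proj.isAffineOpen_basicOpen grading _ (X_mem i) one_pos

lemma basicOpen_t : P1.basicOpen t = U01 := basicOpen_ratio _ _

lemma isAffineOpen_U01 : IsAffineOpen U01 := by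
  rw [← basicOpen_t]
  exact (isAffineOpen_U 0).basicOpen t

lemma exists_laurentEquiv : ∃ φ : ℤ[T;T⁻¹] ≃+* Γ(P1, U01),
    φ (LaurentPolynomial.T 1) = t01 ∧ φ (LaurentPolynomial.T (-1)) = s01 := by
  let : Algebra Γ(P1, U 0) Γ(P1, U01) :=
    (P1.presheaf.map (homOfLE (inf_le_left : U01 ≤ U 0)).op).hom.toAlgebra
  have : IsLocalization.Away t Γ(P1, U01) :=
    (isAffineOpen_U 0).isLocalization_of_eq_basicOpen t _ basicOpen_t.symm
  let h : Polynomial ℤ ≃+* Γ(P1, U 0) := sectionsEquiv (j := 1) (by decide)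
  have hX : h Polynomial.X = t := sectionsEquiv_X _
  let φ : ℤ[T;T⁻¹] ≃+* Γ(P1, U01) :=
    IsLocalization.ringEquivOfRingEquiv (M := Submonoid.powers (Polynomial.X : Polynomial ℤ))
      (T := Submonoid.powers t) _ _ h (by rw [Submonoid.map_powers]; congr 1)
  have h1 : φ (LaurentPolynomial.T 1) = t01 := by
    have := IsLocalization.ringEquivOfRingEquiv_eq (S := ℤ[T;T⁻¹]) (Q := Γ(P1, U01))
      (M := Submonoid.powers (Polynomial.X : Polynomial ℤ))
      (T := Submonoid.powers t) (j := h) (by rw [Submonoid.map_powers]; congr 1) Polynomial.X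
    rw [LaurentPolynomial.algebraMap_eq_toLaurent, Polynomial.toLaurent_X, hX] at this
    exact this
  refine ⟨φ, h1, ?_⟩
  have h2 : φ (LaurentPolynomial.T 1) * φ (LaurentPolynomial.T (-1)) = 1 := by
    rw [← map_mul, ← LaurentPolynomial.T_add]; simp
  have h3 : IsUnit t01 := IsUnit.of_mul_eq_one _ t01_mul_s01
  refine h3.mul_left_cancel ?_
  rw [t01_mul_s01, ← h1, h2]

lemma map_T_eq_zpow {R : Type*} [CommRing R] (ρ : ℤ[T;T⁻¹] →+* R) {u : Rˣ}
    (hu : ρ (LaurentPolynomial.T 1) = u) (n : ℤ) : ρ (LaurentPolynomial.T n) = (u ^ n : Rˣ) := by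
  induction n with
  | zero => simp
  | succ m ih => rw [LaurentPolynomial.T_add, map_mul, ih, hu, zpow_add_one, Units.val_mul]
  | pred m ih =>
    refine u.isUnit.mul_right_cancel ?_
    rw [← hu, ← map_mul, ← LaurentPolynomial.T_add, sub_add_cancel, ih, hu, ← Units.val_mul,
      ← zpow_add_one, sub_add_cancel]

/-- On the overlap, `tⁿ x₀ⁿ = x₁ⁿ`. -/
lemma map_T_smul_xPow {φ : ℤ[T;T⁻¹] ≃+* Γ(P1, U01)} (hφ : φ (LaurentPolynomial.T 1) = t01)
    (n : ℤ) :
    φ (LaurentPolynomial.T n) • (twist n).presheaf.map (homOfLE inf_le_left).op (xPow 0 n) =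
      (twist n).presheaf.map (homOfLE (inf_le_right : U01 ≤ U 1)).op (xPow 1 n) := by
  refine sectionAt_ext fun x hx ↦ ?_
  rw [sectionAt_smul, sectionAt_map, sectionAt_map]
  change _ * ((unitAt grading _ x hx.1 ^ n : (Loc grading x)ˣ) : Loc grading x) =
    ((unitAt grading _ x hx.2 ^ n : (Loc grading x)ˣ) : Loc grading x)
  let ρ : ℤ[T;T⁻¹] →+* Loc grading x := (evalAt grading x hx).comp φ.toRingHom
  have h1 : ρ (LaurentPolynomial.T 1) * unitAt grading (MvPolynomial.X 0) x hx.1 =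
      unitAt grading (MvPolynomial.X 1) x hx.2 := by
    change evalAt grading x hx (φ _) * _ = _
    rw [hφ]
    exact evalAt_ratio_mul (X_mem 1) (X_mem 0) x hx.1
  have h2 : ρ (LaurentPolynomial.T 1) =
      ((unitAt grading _ x hx.2 * (unitAt grading _ x hx.1)⁻¹ : (Loc grading x)ˣ) :
        Loc grading x) := by
    rw [Units.val_mul, ← h1, mul_assoc, Units.mul_inv, mul_one]
  change ρ (LaurentPolynomial.T n) * _ = _
  rw [map_T_eq_zpow ρ h2, ← Units.val_mul, ← mul_zpow, inv_mul_cancel_right]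

variable (k : ℕ) (n : ℤ)

lemma dt01_eq (j : ℕ) : dt01 k n j = dPow toSpecZ k t01 j
    ((twist n).presheaf.map (homOfLE (inf_le_left : U01 ≤ U 0)).op (xPow 0 n)) :=
  map_dPow toSpecZ k _ t j (xPow 0 n)

lemma ds01_eq (p : ℕ) : ds01 k n p = dPow toSpecZ k s01 p
    ((twist n).presheaf.map (homOfLE (inf_le_right : U01 ≤ U 1)).op (xPow 1 n)) :=
  map_dPow toSpecZ k _ s p (xPow 1 n)

lemma dt01_eq_zero {j : ℕ} (hj : k + 1 ≤ j) : dt01 k n j = 0 := by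
  rw [dt01_eq, dPow, pow_eq_zero_of_le hj (diff_pow_eq_zero toSpecZ k isAffineOpen_U01 t01)]
  exact zero_smul Γ(diagNhd toSpecZ k, p toSpecZ k ⁻¹ᵁ U01) (oneTmul k _)

section Transition

variable (φ : ℤ[T;T⁻¹] ≃+* Γ(P1, U01))

/-- A Laurent polynomial in `t`, as a function on `Δᵏ` via the first projection. -/
def leftHom : ℤ[T;T⁻¹] →+* Γ(diagNhd toSpecZ k, p toSpecZ k ⁻¹ᵁ U01) :=
  ((p toSpecZ k).app U01).hom.comp φ.toRingHom

/-- A Laurent polynomial in `t`, as a function on `Δᵏ` via the second projection. -/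
def rightHom : ℤ[T;T⁻¹] →+* Γ(diagNhd toSpecZ k, p toSpecZ k ⁻¹ᵁ U01) :=
  (qApp toSpecZ U01 k).comp φ.toRingHom

variable {φ}

lemma rightHom_sub_leftHom (a : ℤ[T;T⁻¹]) :
    rightHom k φ a - leftHom k φ a = diff toSpecZ k (φ a) := rfl

lemma rightHom_sub_leftHom_pow (a : ℤ[T;T⁻¹]) :
    (rightHom k φ a - leftHom k φ a) ^ (k + 1) = 0 := by
  rw [rightHom_sub_leftHom, diff_pow_eq_zero toSpecZ k isAffineOpen_U01]

/-- An expansion of `dsᵖ tⁿ`, with `t` pulled back along `q`, in powers of `dt` gives the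
coordinates of `dsᵖ ⊗ x₁ⁿ`. -/
lemma ds01_eq_sum (ht : φ (LaurentPolynomial.T 1) = t01)
    (hs : φ (LaurentPolynomial.T (-1)) = s01) {p : ℕ} {S : Finset ℕ} {c : ℕ → ℤ[T;T⁻¹]}
    (h : (rightHom k φ (LaurentPolynomial.T (-1)) - leftHom k φ (LaurentPolynomial.T (-1))) ^ p *
        rightHom k φ (LaurentPolynomial.T n) = ∑ j ∈ S, leftHom k φ (c j) *
      (rightHom k φ (LaurentPolynomial.T 1) - leftHom k φ (LaurentPolynomial.T 1)) ^ j) :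
    ds01 k n p = ∑ j ∈ S, φ (c j) • dt01 k n j := by
  simp only [dt01_eq]
  rw [ds01_eq, sum_smul_dPow toSpecZ k S t01 _ (fun j ↦ φ (c j)) fun j ↦ j,
    ← map_T_smul_xPow ht]
  unfold dPow
  rw [oneTmul_smul, smul_smul]
  rw [rightHom_sub_leftHom, rightHom_sub_leftHom, ht, hs] at h
  exact congrArg (fun z ↦ (z • oneTmul k _ :
    Γ((Scheme.Modules.pullback (q toSpecZ k)).obj (twist n), _))) h

end Transition

end P1Z

end

theorem mainTheorem2 (k : ℕ) (hk : 1 ≤ k) (n : ℤ) :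
    ∃ (φ : ℤ[T;T⁻¹] ≃+* Γ(P1Z.P1, P1Z.U01))
      (B₀ : Module.Basis (Fin (k + 1)) Γ(P1Z.P1, P1Z.U 0) Γ(P1Z.PP k n, P1Z.U 0))
      (B₁ : Module.Basis (Fin (k + 1)) Γ(P1Z.P1, P1Z.U 1) Γ(P1Z.PP k n, P1Z.U 1))
      (B B' : Module.Basis (Fin (k + 1)) Γ(P1Z.P1, P1Z.U01) Γ(P1Z.PP k n, P1Z.U01))
      (L : GL (Fin (k + 1)) ℤ[T;T⁻¹]),
      φ (LaurentPolynomial.T 1) = P1Z.t01 ∧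
      φ (LaurentPolynomial.T (-1)) = P1Z.s01 ∧
      (∀ j, B₀ j = P1Z.dt k n j) ∧
      (∀ p, B₁ p = P1Z.ds k n p) ∧
      (∀ j, B j = P1Z.dt01 k n j) ∧
      (∀ p, B' p = P1Z.ds01 k n p) ∧
      B.toMatrix B' = (L : Matrix (Fin (k + 1)) (Fin (k + 1)) ℤ[T;T⁻¹]).map φ ∧
      (n < 0 → ∀ p : ℕ, p ≤ k →
        P1Z.ds01 k n p = ∑ j ∈ Finset.Icc p k,
          φ (((-1) ^ j * ((j - n - 1).toNat.choose (p - n - 1).toNat : ℤ)) •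
            LaurentPolynomial.T (n - p - j)) • P1Z.dt01 k n j) ∧
      ((k : ℤ) ≤ n → ∀ p : ℕ, p ≤ k →
        P1Z.ds01 k n p = ∑ j ∈ Finset.Icc p k,
          φ (((-1) ^ p * ((n - p).toNat.choose (j - p) : ℤ)) •
            LaurentPolynomial.T (n - p - j)) • P1Z.dt01 k n j) ∧
      (0 ≤ n → n < k →
        (∀ p : ℕ, (p : ℤ) ≤ n →
          P1Z.ds01 k n p = ∑ j ∈ Finset.Icc p n.toNat,
            φ (((-1) ^ p * ((n - p).toNat.choose (j - p) : ℤ)) •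
              LaurentPolynomial.T (n - p - j)) • P1Z.dt01 k n j) ∧
        (∀ p : ℕ, n < p → p ≤ k →
          P1Z.ds01 k n p = ∑ j ∈ Finset.Icc p k,
            φ (((-1) ^ j * ((j - n - 1).toNat.choose (p - n - 1).toNat : ℤ)) •
              LaurentPolynomial.T (n - p - j)) • P1Z.dt01 k n j)) := by
  obtain ⟨φ, ht, hs⟩ := P1Z.exists_laurentEquiv
  have ht01 : PrincipalParts.IsCoordinate P1Z.t01 :=
    ht ▸ PrincipalParts.IsCoordinate.laurent_T.map_equiv φ
  have hs01 : PrincipalParts.IsCoordinate P1Z.s01 :=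
    hs ▸ PrincipalParts.IsCoordinate.laurent_T_neg.map_equiv φ
  have h₀ := ProjTwist.trivializes_powSection (P1Z.X_mem 0) n
  have h₁ := ProjTwist.trivializes_powSection (P1Z.X_mem 1) n
  obtain ⟨B₀, hB₀⟩ := PrincipalParts.exists_basis_dPow P1Z.toSpecZ k (P1Z.isAffineOpen_U 0)
    P1Z.isCoordinate_t h₀
  obtain ⟨B₁, hB₁⟩ := PrincipalParts.exists_basis_dPow P1Z.toSpecZ k (P1Z.isAffineOpen_U 1)
    P1Z.isCoordinate_s h₁
  obtain ⟨B, hB⟩ := PrincipalParts.exists_basis_dPow P1Z.toSpecZ k P1Z.isAffineOpen_U01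
    ht01 (h₀.map (inf_le_left : P1Z.U01 ≤ P1Z.U 0))
  obtain ⟨B', hB'⟩ := PrincipalParts.exists_basis_dPow P1Z.toSpecZ k P1Z.isAffineOpen_U01
    hs01 (h₁.map (inf_le_right : P1Z.U01 ≤ P1Z.U 1))
  have key_lt (p : ℕ) (hnp : n < p) (hp : p ≤ k) := P1Z.ds01_eq_sum k n ht hs
    (PrincipalParts.pow_mul_map_T_eq_sum_of_lt (P1Z.leftHom k φ) (P1Z.rightHom k φ) hnp hp
      (P1Z.rightHom_sub_leftHom_pow k _))
  have key_le (p : ℕ) (hnp : (p : ℤ) ≤ n) := P1Z.ds01_eq_sum k n ht hs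
    (PrincipalParts.pow_mul_map_T_eq_sum_of_le (P1Z.leftHom k φ) (P1Z.rightHom k φ) hnp)
  let L : GL (Fin (k + 1)) ℤ[T;T⁻¹] :=
    { val := (B.toMatrix B').map φ.symm
      inv := (B'.toMatrix B).map φ.symm
      val_inv := by
        rw [← Matrix.map_mul, Module.Basis.toMatrix_mul_toMatrix_flip,
          Matrix.map_one _ (map_zero _) (map_one _)]
      inv_val := by
        rw [← Matrix.map_mul, Module.Basis.toMatrix_mul_toMatrix_flip,
          Matrix.map_one _ (map_zero _) (map_one _)] }
  refine ⟨φ, B₀, B₁, B, B', L, ht, hs, hB₀, hB₁, fun j ↦ (hB j).trans (P1Z.dt01_eq k n j).symm,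
    fun p ↦ (hB' p).trans (P1Z.ds01_eq k n p).symm, ?_, fun hn p hp ↦ key_lt p (by omega) hp,
    fun hkn p hp ↦ ?_, fun hn hnk ↦ ⟨key_le, key_lt⟩⟩
  · ext i j
    simp [L]
  · -- The terms of the binomial expansion with `j > k` vanish since `dt ^ (k + 1) = 0`.
    rw [key_le p (by omega)]
    refine (Finset.sum_subset (Finset.Icc_subset_Icc_right (by omega)) fun j hj hjk ↦ ?_).symm
    have hj' : k + 1 ≤ j := by
      rw [Finset.mem_Icc] at hj hjk
      omega
    rw [P1Z.dt01_eq_zero k n hj', smul_zero]
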